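/- Setting. Let $P$ be a $k\times k$ matrix with entries in $\{0,1\}$ and no null row, let $\Omega=\{(x_n)_{n\in\mathbb Z}: P_{x_n,x_{n+1}}=1 \text{ for all } n\}$ be the two-sided subshift of finite type it defines, with shift $\sigma$, and fix $\rho>1$ and the distance $d_\Omega(x,y)=\rho^{-N}$, where $N$ is the largest integer $N\ge 0$ with $x_n=y_n$ for all $|n|<N$ (and $d_\Omega(x,x)=0$). Let $G$ be a compact topological group (written additively, not necessarily commutative) whose topology is given by a metric $d$. For maps $h,h':G\to G$ put $d_\infty(h,h')=\sup_p d(h(p),h'(p))$; let $H_\beta(h)$ be the least $\beta$-Hölder constant of $h$, and $L=H_1$. Let $\operatorname{Hom}(G)$ be the set of homeomorphisms of $G$, $\operatorname{Hol}_\beta(G)$ the set of $h\in\operatorname{Hom}(G)$ such that $h$ and $h^{-1}$ are $\beta$-Hölder, and $\operatorname{Lip}(G)=\operatorname{Hol}_1(G)$, with $d_1(h,h')=d_\infty(h,h')+L(h-h')$. Let $\alpha>0$ and $0<\beta\le1$, and let $f,g:\Omega\to(\operatorname{Lip}(G),d_1)$ be $\alpha$-Hölder. Write $f^n_x=f_{\sigma^{n-1}(x)}\circ\dots\circ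 f_x$ and $f^{-n}_x=(f^n_{\sigma^{-n}(x)})^{-1}$ for $n\ge 0$. Let $\mu$ be an ergodic $\sigma$-invariant Borel probability measure on $\Omega$ with full support and local product structure: there is a continuous $\xi:\Omega\to(0,\infty)$ such that for every symbol $i$ and every measurable $E\subseteq[0;i]=\{x\in\Omega:x_0=i\}$, $$\mu(E)=\int(\chi_E\circ\psi_i)\,(\xi\circ\psi_i)\;d(\mu^u\times\mu^s),$$ where $\mu^u=P^u_*\mu$ and $\mu^s=P^s_*\mu$ are the images of $\mu$ under the projections $P^u,P^s$ to the coordinates $n\le0$ and $n\ge0$, and $\psi_i:P^u([0;i])\times P^s([0;i])\to[0;i]$ joins a past and a future. Suppose that * $f$ is su-dominated: there is $\theta>0$ with $L(f_x^{-1})<\rho^{\alpha-\theta}$ for all $x\in\Omega$, and there is $\theta'>0$ with $L(f_x)<\rho^{\alpha-\theta'}$ for all $x\in\Omega$; * $g$ has $\mu$-bounded distortion: there is $K$ such that $L(g^n_x)<K$ and $L((g^n_x)^{-1})<K$ for all $n\ge0$ and $\mu$-almost every $x$; * $\phi:\Omega\to(\operatorname{Hol}_\beta(G),d_\infty)$ is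 $\mu$-measurable and $f_x=\phi_{\sigma(x)}\circ g_x\circ\phi_x^{-1}$ for all $x\in\Omega$; * the Hölder constants of $\phi_x$, as elements of $\operatorname{Hol}_\beta(G)$, are uniformly bounded: there is $M$ with $H_\beta(\phi_x)\le M$ and $H_\beta(\phi_x^{-1})\le M$ for all $x\in\Omega$. Say that the holonomies of $f$ are $\gamma$-Hölder if the uniform limits $h^s_{xy}=\lim_{n\to\infty}(f^n_y)^{-1}f^n_x$ (for $x_n=y_n$ for all $n\ge0$) and $h^u_{xy}=\lim_{n\to\infty}(f^{-n}_y)^{-1}f^{-n}_x$ (for $x_n=y_n$ for all $n\le0$) exist in $\operatorname{Hom}(G)$ and are $\gamma$-Hölder with a constant that does not depend on $x,y$. Then the holonomies of $f$ are $\gamma$-Hölder for some $\gamma\in(0,\alpha)$, and there is $\tilde\phi:\Omega\to\operatorname{Hom}(G)$ such that * $\tilde\phi:(\Omega,d_\Omega)\to(\operatorname{Hom}(G),d_\infty)$ is $\beta\gamma$-Hölder for every $\gamma\in(0,\alpha)$ for which the holonomies of $f$ are $\gamma$-Hölder; * $\tilde\phi_x=\phi_x$ for $\mu$-almost every $x$;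 * $f_x=\tilde\phi_{\sigma(x)}\circ g_x\circ\tilde\phi_x^{-1}$ for all $x\in\Omega$; * $\tilde\phi_x\in\operatorname{Hol}_\beta(G)$ for all $x\in\Omega$. -/

import Mathlib

open MeasureTheory Filter Topology
open scoped NNReal ENNReal

namespace LipCocycle

noncomputable section

/-! ### Subshifts of finite type -/

/-- A `0`-`1` matrix without null rows. -/
def IsTransitionMatrix {k : ℕ} (P : Matrix (Fin k) (Fin k) ℕ) : Prop :=
  (∀ i j, P i j = 0 ∨ P i j = 1) ∧ ∀ i, ∃ j, P i j = 1

/-- The two-sided subshift `Ω` with transition matrix `P`. As a subtype of `ℤ → Fin k` it carries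
the product topology and the product (= Borel) `σ`-algebra. -/
def Subshift {k : ℕ} (P : Matrix (Fin k) (Fin k) ℕ) : Type :=
  {x : ℤ → Fin k // ∀ n : ℤ, P (x n) (x (n + 1)) = 1}

variable {k : ℕ} {P : Matrix (Fin k) (Fin k) ℕ}

instance : TopologicalSpace (Subshift P) :=
  inferInstanceAs (TopologicalSpace {x : ℤ → Fin k // ∀ n : ℤ, P (x n) (x (n + 1)) = 1})

instance : MeasurableSpace (Subshift P) :=
  inferInstanceAs (MeasurableSpace {x : ℤ → Fin k // ∀ n : ℤ, P (x n) (x (n + 1)) = 1})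

/-- The shift map `(σ x) n = x (n + 1)`, with its inverse. -/
def shift (P : Matrix (Fin k) (Fin k) ℕ) : Subshift P ≃ Subshift P where
  toFun x := ⟨fun n => x.1 (n + 1), fun n => x.2 (n + 1)⟩
  invFun x := ⟨fun n => x.1 (n - 1), fun n => by
    have h := x.2 (n - 1)
    rwa [show n - 1 + 1 = n + 1 - 1 by ring] at h⟩
  left_inv x := Subtype.ext (funext fun n => congrArg x.1 (by ring))
  right_inv x := Subtype.ext (funext fun n => congrArg x.1 (by ring))

open Classical in
/-- The distance `ρ ^ (-N)`, with `N` the largest natural number such that `x n = y n` whenever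
`|n| < N` (and distance `0` if `x = y`). -/
def shiftDist (ρ : ℝ) (x y : Subshift P) : ℝ :=
  if x = y then 0
  else (ρ ^ sSup {N : ℕ | ∀ n : ℤ, |n| < (N : ℤ) → x.1 n = y.1 n})⁻¹

/-- The local stable set of `x`. -/
def localStable (x : Subshift P) : Set (Subshift P) :=
  {y | ∀ n : ℤ, 0 ≤ n → x.1 n = y.1 n}

/-- The local unstable set of `x`. -/
def localUnstable (x : Subshift P) : Set (Subshift P) :=
  {y | ∀ n : ℤ, n ≤ 0 → x.1 n = y.1 n}

/-! ### Local product structure -/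

/-- The projection `P^s` to the coordinates `n ≥ 0`. -/
def future (x : Subshift P) : ℕ → Fin k := fun n => x.1 (n : ℤ)

/-- The projection `P^u` to the coordinates `n ≤ 0` (the `n`-th entry is the coordinate `-n`). -/
def past (x : Subshift P) : ℕ → Fin k := fun n => x.1 (-(n : ℤ))

/-- The cylinder `[0; i]`. -/
def cylinder (P : Matrix (Fin k) (Fin k) ℕ) (i : Fin k) : Set (Subshift P) := {x | x.1 0 = i}

/-- The bi-infinite sequence with past `p.1` and future `p.2`. -/
def glue (p : (ℕ → Fin k) × (ℕ → Fin k)) : ℤ → Fin k :=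
  fun n => if 0 ≤ n then p.2 n.toNat else p.1 (-n).toNat

theorem glue_mem {i : Fin k} {p : (ℕ → Fin k) × (ℕ → Fin k)}
    (hp : p ∈ (past '' cylinder P i) ×ˢ (future '' cylinder P i)) (n : ℤ) :
    P (glue p n) (glue p (n + 1)) = 1 := by
  obtain ⟨⟨x, hx, hx'⟩, ⟨y, hy, hy'⟩⟩ := hp
  have e1 : ∀ m : ℤ, 0 ≤ m → glue p m = y.1 m := by
    intro m hm
    simp [glue, hm, ← hy', future]
  have e2 : ∀ m : ℤ, m ≤ 0 → glue p m = x.1 m := by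
    intro m hm
    rcases hm.lt_or_eq with h | h
    · simp [glue, not_le.mpr h, ← hx', past, max_eq_left (neg_nonneg.mpr hm)]
    · subst h
      rw [e1 0 le_rfl]
      exact Eq.trans hy (Eq.symm hx)
  rcases le_or_gt 0 n with h | h
  · rw [e1 n h, e1 (n + 1) (by omega)]
    exact y.2 n
  · rw [e2 n h.le, e2 (n + 1) (by omega)]
    exact x.2 n

/-- The map `ψ_i : P^u([0; i]) × P^s([0; i]) → [0; i]` that joins a past and a future. -/
def join (i : Fin k)
    (p : ((past '' cylinder P i) ×ˢ (future '' cylinder P i) :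
      Set ((ℕ → Fin k) × (ℕ → Fin k)))) : Subshift P :=
  ⟨glue p.1, glue_mem p.2⟩

open Classical in
/-- Local product structure: there is a continuous `ξ : Ω → (0, ∞)` such that, for every symbol `i`
and every measurable `E ⊆ [0; i]`, `μ E` is the integral of `(χ_E ∘ ψ_i) (ξ ∘ ψ_i)` over
`P^u([0; i]) × P^s([0; i])` with respect to `(P^u_* μ) × (P^s_* μ)`. -/
def HasLocalProductStructure (μ : Measure (Subshift P)) : Prop :=
  ∃ ξ : Subshift P → ℝ, Continuous ξ ∧ (∀ x, 0 < ξ x) ∧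
    ∀ (i : Fin k) (E : Set (Subshift P)), MeasurableSet E → E ⊆ cylinder P i →
      μ E = ∫⁻ p, (if hp : p ∈ (past '' cylinder P i) ×ˢ (future '' cylinder P i) then
          E.indicator (fun x => ENNReal.ofReal (ξ x)) (join i ⟨p, hp⟩) else 0)
        ∂((μ.map past).prod (μ.map future))

/-! ### Hölder homeomorphisms of the fibre

`eHolderNorm β h : ℝ≥0∞` is the least `β`-Hölder constant of `h` (and `⊤` if there is none). The
product `h * h'` of homeomorphisms is the composition `h ∘ h'`. -/

variable {G : Type*} [AddGroup G] [MetricSpace G]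

/-- The uniform distance `d_∞`. -/
def uniformDist (h h' : G ≃ₜ G) : ℝ≥0∞ := ⨆ p, edist (h p) (h' p)

/-- The Hölder distance `d_β (h, h') = d_∞ (h, h') + H_β (h - h')`; `d_1` is the Lipschitz metric. -/
def holderDist (β : ℝ≥0) (h h' : G ≃ₜ G) : ℝ≥0∞ :=
  uniformDist h h' + eHolderNorm β (fun p => h p - h' p)

/-- `Hol_β(G)`: the `β`-Hölder homeomorphisms with `β`-Hölder inverse. -/
def Hol (G : Type*) [MetricSpace G] (β : ℝ≥0) : Set (G ≃ₜ G) :=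
  {h | MemHolder β h ∧ MemHolder β (h⁻¹ : G ≃ₜ G)}

/-- `Lip(G) = Hol_1(G)`. -/
def Lip (G : Type*) [MetricSpace G] : Set (G ≃ₜ G) := Hol G 1

/-- The least Lipschitz constant `L(h)`. -/
def lipConst (h : G ≃ₜ G) : ℝ≥0∞ := eHolderNorm 1 h

/-- `h` is an `η`-Hölder map from `(Ω, d_Ω)` to the homeomorphisms of `G` with the uniform
distance. -/
def IsUniformHolder (ρ η : ℝ) (h : Subshift P → G ≃ₜ G) : Prop :=
  ∃ C : ℝ≥0, ∀ x y, uniformDist (h x) (h y) ≤ ENNReal.ofReal (C * shiftDist ρ x y ^ η)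

/-- `h` is `μ`-measurable with respect to the Borel `σ`-algebra of the uniform distance. -/
def IsUniformMeasurable (μ : Measure (Subshift P)) (h : Subshift P → G ≃ₜ G) : Prop :=
  ∀ U : Set (G ≃ₜ G),
    (∀ u ∈ U, ∃ ε : ℝ≥0∞, 0 < ε ∧ ∀ v, uniformDist u v < ε → v ∈ U) →
      NullMeasurableSet (h ⁻¹' U) μ

/-! ### Cocycles -/

/-- `f` belongs to `Hol_α(Ω, Lip(G))`, where `Lip(G)` carries the Lipschitz metric `d_1`. -/
def IsHolderCocycle (ρ : ℝ) (α : ℝ≥0) (f : Subshift P → G ≃ₜ G) : Prop :=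
  (∀ x, f x ∈ Lip G) ∧
    ∃ C : ℝ≥0, ∀ x y, holderDist 1 (f x) (f y) ≤ ENNReal.ofReal (C * shiftDist ρ x y ^ (α : ℝ))

/-- The iterates `f^n_x = f_{σ^{n-1} x} ∘ ⋯ ∘ f_x`. -/
def iter (f : Subshift P → G ≃ₜ G) : ℕ → Subshift P → G ≃ₜ G
  | 0, _ => 1
  | n + 1, x => f ((shift P)^[n] x) * iter f n x

/-- The backward iterates `f^{-n}_x = (f^n_{σ^{-n} x})⁻¹`. -/
def backIter (f : Subshift P → G ≃ₜ G) (n : ℕ) (x : Subshift P) : G ≃ₜ G :=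
  (iter f n ((shift P).symm^[n] x))⁻¹

def IsSDominated (ρ : ℝ) (α : ℝ≥0) (f : Subshift P → G ≃ₜ G) : Prop :=
  ∃ θ : ℝ, 0 < θ ∧ ∀ x, lipConst (f x)⁻¹ < ENNReal.ofReal (ρ ^ ((α : ℝ) - θ))

def IsUDominated (ρ : ℝ) (α : ℝ≥0) (f : Subshift P → G ≃ₜ G) : Prop :=
  ∃ θ : ℝ, 0 < θ ∧ ∀ x, lipConst (f x) < ENNReal.ofReal (ρ ^ ((α : ℝ) - θ))

def IsSUDominated (ρ : ℝ) (α : ℝ≥0) (f : Subshift P → G ≃ₜ G) : Prop :=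
  IsSDominated ρ α f ∧ IsUDominated ρ α f

/-- `μ`-bounded distortion. -/
def HasBoundedDistortion (μ : Measure (Subshift P)) (g : Subshift P → G ≃ₜ G) : Prop :=
  ∃ K : ℝ≥0, ∀ᵐ x ∂μ, ∀ n : ℕ, lipConst (iter g n x) < K ∧ lipConst (iter g n x)⁻¹ < K

/-- `h` is the stable holonomy from the fibre of `x` to the fibre of `y`: the uniform limit of
`(f^n_y)⁻¹ ∘ f^n_x`. -/
def IsStableHolonomy (f : Subshift P → G ≃ₜ G) (x y : Subshift P) (h : G ≃ₜ G) : Prop :=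
  Tendsto (fun n => uniformDist ((iter f n y)⁻¹ * iter f n x) h) atTop (𝓝 0)

/-- `h` is the unstable holonomy from the fibre of `x` to the fibre of `y`: the uniform limit of
`(f^{-n}_y)⁻¹ ∘ f^{-n}_x`. -/
def IsUnstableHolonomy (f : Subshift P → G ≃ₜ G) (x y : Subshift P) (h : G ≃ₜ G) : Prop :=
  Tendsto (fun n => uniformDist ((backIter f n y)⁻¹ * backIter f n x) h) atTop (𝓝 0)

/-- The stable and unstable holonomies of `f` along local stable and local unstable sets exist and
are `γ`-Hölder, with a Hölder constant that does not depend on the points. -/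
def HasHolderHolonomies (f : Subshift P → G ≃ₜ G) (γ : ℝ≥0) : Prop :=
  ∃ C : ℝ≥0,
    (∀ x, ∀ y ∈ localStable x, ∃ h, IsStableHolonomy f x y h ∧ eHolderNorm γ h ≤ C) ∧
    (∀ x, ∀ y ∈ localUnstable x, ∃ h, IsUnstableHolonomy f x y h ∧ eHolderNorm γ h ≤ C)

/-- `φ` is a conjugacy between the cocycles: `f_x = φ_{σ x} ∘ g_x ∘ φ_x⁻¹` for every `x`. -/
def IsConjugacy (f g φ : Subshift P → G ≃ₜ G) : Prop :=
  ∀ x, f x = φ (shift P x) * g x * (φ x)⁻¹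

end

end LipCocycle

open LipCocycle

/-!
Write `Agree N x y` for equality of the coordinates `|n| < N`, and `r = ρ ^ (-α)`, so that `f` and
`g` vary by `O(r ^ N)` between points that agree to order `N`.

*Holonomies.* If `x` and `y` have the same future, the maps `(f^n_y)⁻¹ ∘ f^n_x` form a Cauchy
sequence: consecutive terms differ by at most `Lip((f^{n+1}_y)⁻¹) r ^ n`, and domination makes this
geometric (`uniformDist_compSeq_le`). Their Lipschitz constants grow at most exponentially, so
interpolation shows that the limit is Hölder (`holderWith_of_geometric_approx`). Unstable holonomies
are stable ones for the inverse fibre maps along backward orbits, so everything is proved for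
abstract sequences of homeomorphisms.

*Regularity along leaves.* From `f^n_x = φ_{σ^n x} ∘ g^n_x ∘ φ_x⁻¹`, and the same at `y`, the map
`(f^n_y)⁻¹ ∘ f^n_x` is `φ_y ∘ (g^n_y)⁻¹ ∘ (φ_{σ^n y}⁻¹ ∘ φ_{σ^n x}) ∘ g^n_x ∘ φ_x⁻¹`. When
`φ_{σ^n x}` and `φ_{σ^n y}` are close, the factor in the middle is close to the identity, and since
`(f^n_y)⁻¹ ∘ f^n_x` and `(g^n_y)⁻¹ ∘ g^n_x` are `O(r ^ N)`-close to the identity, `φ_x` and `φ_y` are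
`O(r ^ (β N))`-close (`uniformDist_le_of_conj`). For almost all pairs such times `n` exist: by
Lusin's theorem `φ` oscillates little off sets of summable measure, and the Borel-Cantelli lemma
applies along suitable times (`exists_ae_edist_iterate_lt`).

*From leaves to `Ω`.* By local product structure the bracket of almost every pair of points is a good
point (`HasLocalProductStructure.ae_bracket`), hence `φ` is Hölder on a set of full measure by Fubini's
theorem (`exists_geomHolderOn`). This set is dense, `φ` extends by completeness
(`GeomHolderOn.exists_extension`), and the conjugacy equation extends by continuity. The extension is
`βα`-Hölder, which is more than `βγ`-Hölder for every `γ < α`.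
-/

namespace LipCocycle

/-! ### Uniform distance of homeomorphisms -/

section Homeo

variable {G : Type*} [MetricSpace G]

theorem edist_le_uniformDist (h h' : G ≃ₜ G) (p : G) : edist (h p) (h' p) ≤ uniformDist h h' :=
  le_iSup (fun p => edist (h p) (h' p)) p

theorem uniformDist_self (h : G ≃ₜ G) : uniformDist h h = 0 := by
  simp [uniformDist]

theorem uniformDist_comm (h h' : G ≃ₜ G) : uniformDist h h' = uniformDist h' h := by
  simp only [uniformDist, edist_comm]

theorem uniformDist_triangle (h₁ h₂ h₃ : G ≃ₜ G) :
    uniformDist h₁ h₃ ≤ uniformDist h₁ h₂ + uniformDist h₂ h₃ :=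
  iSup_le fun p => (edist_triangle _ (h₂ p) _).trans
    (add_le_add (edist_le_uniformDist _ _ p) (edist_le_uniformDist _ _ p))

theorem uniformDist_mul_right (h h' k : G ≃ₜ G) :
    uniformDist (h * k) (h' * k) = uniformDist h h' :=
  k.toEquiv.iSup_comp (g := fun p => edist (h p) (h' p))

theorem uniformDist_mul_left_le {C r : ℝ≥0} {k : G ≃ₜ G} (hk : HolderWith C r k) (h h' : G ≃ₜ G) :
    uniformDist (k * h) (k * h') ≤ C * uniformDist h h' ^ (r : ℝ) :=
  iSup_le fun p => (hk (h p) (h' p)).trans <| by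
    gcongr
    exact edist_le_uniformDist h h' p

theorem uniformDist_mul_left_le_of_lipschitz {C : ℝ≥0} {k : G ≃ₜ G} (hk : LipschitzWith C k)
    (h h' : G ≃ₜ G) : uniformDist (k * h) (k * h') ≤ C * uniformDist h h' := by
  simpa using uniformDist_mul_left_le (holderWith_one.2 hk) h h'

theorem uniformDist_inv_le {C r : ℝ≥0} {h : G ≃ₜ G} (hh : HolderWith C r (h⁻¹ : G ≃ₜ G))
    (h' : G ≃ₜ G) : uniformDist h⁻¹ h'⁻¹ ≤ C * uniformDist h h' ^ (r : ℝ) := by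
  have := uniformDist_mul_left_le hh h' h
  rwa [inv_mul_cancel, ← uniformDist_mul_right _ _ h'⁻¹, mul_assoc, mul_inv_cancel, mul_one,
    one_mul, uniformDist_comm h' h] at this

theorem holderWith_of_eHolderNorm_le {X Y : Type*} [MetricSpace X] [MetricSpace Y]
    {C r : ℝ≥0} {h : X → Y} (hh : eHolderNorm r h ≤ C) : HolderWith C r h := by
  have hm : MemHolder r h := eHolderNorm_ne_top.1 (hh.trans_lt ENNReal.coe_lt_top).ne
  refine fun p q => (hm.holderWith p q).trans ?_
  gcongr
  exact ENNReal.coe_le_coe.1 (coe_nnHolderNorm_le_eHolderNorm.trans hh)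

/-- The uniform distance is the distance of `C(G, G)`. -/
theorem uniformDist_eq_edist [CompactSpace G] (h h' : G ≃ₜ G) :
    uniformDist h h' = edist (h : C(G, G)) (h' : C(G, G)) := by
  rw [ContinuousMap.edist_eq_iSup]; rfl

theorem exists_edist_le (G : Type*) [MetricSpace G] [CompactSpace G] :
    ∃ D : ℝ≥0, ∀ p q : G, edist p q ≤ D := by
  refine ⟨(Metric.ediam (Set.univ : Set G)).toNNReal, fun p q => ?_⟩
  rw [ENNReal.coe_toNNReal (isCompact_univ.isBounded.ediam_ne_top)]
  exact Metric.edist_le_ediam_of_mem trivial trivial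

theorem holderWith_of_tendsto {C r : ℝ≥0} {h : ℕ → G ≃ₜ G} {h' : G ≃ₜ G}
    (hh : ∀ n, HolderWith C r (h n)) (hlim : Tendsto (fun n => uniformDist (h n) h') atTop (𝓝 0)) :
    HolderWith C r h' := by
  have key : ∀ p, Tendsto (fun n => h n p) atTop (𝓝 (h' p)) := fun p =>
    tendsto_iff_edist_tendsto_0.2 <| tendsto_of_tendsto_of_tendsto_of_le_of_le tendsto_const_nhds
      hlim (fun _ => zero_le) fun n => edist_le_uniformDist _ _ p
  intro p q
  exact le_of_tendsto ((key p).edist (key q)) (Eventually.of_forall fun n => hh n p q)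

/-- The homeomorphisms of a compact space are complete for the bilateral uniform distance (the
inverses have to be Cauchy as well), with explicit rates `e` and `e'`. -/
theorem exists_uniform_limit [CompactSpace G] {h : ℕ → G ≃ₜ G} {e e' : ℕ → ℝ≥0∞}
    (he : Tendsto e atTop (𝓝 0)) (he' : Tendsto e' atTop (𝓝 0))
    (hh : ∀ n m, n ≤ m → uniformDist (h n) (h m) ≤ e n)
    (hh' : ∀ n m, n ≤ m → uniformDist (h n)⁻¹ (h m)⁻¹ ≤ e' n) :
    ∃ h' : G ≃ₜ G, (∀ n, uniformDist (h n) h' ≤ e n) ∧ ∀ n, uniformDist (h n)⁻¹ h'⁻¹ ≤ e' n := by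
  have lim : ∀ (k : ℕ → G ≃ₜ G) (d : ℕ → ℝ≥0∞), Tendsto d atTop (𝓝 0) →
      (∀ n m, n ≤ m → uniformDist (k n) (k m) ≤ d n) →
      ∃ K : G → G, Continuous K ∧ ∀ n p, edist (k n p) (K p) ≤ d n := by
    intro k d hd hk
    have hc : ∀ p, ∃ q, Tendsto (fun n => k n p) atTop (𝓝 q) := fun p => by
      refine cauchySeq_tendsto_of_complete (EMetric.cauchySeq_iff'.2 fun ε hε => ?_)
      obtain ⟨N, hN⟩ := (hd.eventually (gt_mem_nhds hε)).exists
      refine ⟨N, fun n hn => ?_⟩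
      rw [edist_comm]
      exact ((edist_le_uniformDist _ _ p).trans (hk N n hn)).trans_lt hN
    choose K hK using hc
    have hb : ∀ n p, edist (k n p) (K p) ≤ d n := fun n p =>
      le_of_tendsto (tendsto_const_nhds.edist (hK p)) <|
        (eventually_ge_atTop n).mono fun m hm => (edist_le_uniformDist _ _ p).trans (hk n m hm)
    refine ⟨K, ?_, hb⟩
    have hu : TendstoUniformly (fun n => (k n : G → G)) K atTop := by
      refine EMetric.tendstoUniformly_iff.2 fun ε hε => ?_
      filter_upwards [hd.eventually (gt_mem_nhds hε)] with n hn p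
      rw [edist_comm]
      exact (hb n p).trans_lt hn
    exact hu.continuous (Frequently.of_forall fun n => (k n).continuous)
  obtain ⟨K, hKc, hK⟩ := lim h e he hh
  obtain ⟨K', hKc', hK'⟩ := lim (fun n => (h n)⁻¹) e' he' hh'
  have inv : ∀ (k k' : ℕ → G ≃ₜ G) (d d' : ℕ → ℝ≥0∞) (F F' : G → G),
      Tendsto d atTop (𝓝 0) → Tendsto d' atTop (𝓝 0) → Continuous F →
      (∀ n p, edist (k n p) (F p) ≤ d n) → (∀ n p, edist (k' n p) (F' p) ≤ d' n) →
      (∀ n p, k n (k' n p) = p) → ∀ p, F (F' p) = p := by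
    intro k k' d d' F F' hd hd' hF hk hk' hinv p
    have h1 : Tendsto (fun n => k' n p) atTop (𝓝 (F' p)) :=
      tendsto_iff_edist_tendsto_0.2 <| tendsto_of_tendsto_of_tendsto_of_le_of_le tendsto_const_nhds
        hd' (fun _ => zero_le) fun n => hk' n p
    have h2 : Tendsto (fun n => F (k' n p)) atTop (𝓝 p) := by
      refine tendsto_iff_edist_tendsto_0.2 <| tendsto_of_tendsto_of_tendsto_of_le_of_le
        tendsto_const_nhds hd (fun _ => zero_le) fun n => ?_
      have := hk n (k' n p)
      rwa [hinv, edist_comm] at this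
    exact tendsto_nhds_unique ((hF.tendsto _).comp h1) h2
  let H : G ≃ₜ G :=
    { toFun := K
      invFun := K'
      left_inv := inv (fun n => (h n)⁻¹) h e' e K' K he' he hKc' hK' hK
        fun n p => (h n).symm_apply_apply p
      right_inv := inv h (fun n => (h n)⁻¹) e e' K K' he he' hKc hK hK'
        fun n p => (h n).apply_symm_apply p
      continuous_toFun := hKc
      continuous_invFun := hKc' }
  exact ⟨H, fun n => iSup_le fun p => hK n p, fun n => iSup_le fun p => hK' n p⟩

end Homeo

/-! ### Holonomies of sequences of homeomorphisms -/

section Sequences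

variable {G : Type*} [MetricSpace G]

/-- The composition `a_{n-1} ∘ ⋯ ∘ a_0` of the first `n` terms of a sequence of homeomorphisms. -/
def compSeq (a : ℕ → G ≃ₜ G) : ℕ → G ≃ₜ G
  | 0 => 1
  | n + 1 => a n * compSeq a n

theorem lipschitzWith_compSeq {a : ℕ → G ≃ₜ G} {l : ℝ≥0} (ha : ∀ n, LipschitzWith l (a n)) (n : ℕ) :
    LipschitzWith (l ^ n) (compSeq a n) := by
  induction n with
  | zero => rw [pow_zero]; exact LipschitzWith.id
  | succ n ih => rw [pow_succ']; exact (ha n).comp ih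

theorem lipschitzWith_compSeq_inv {a : ℕ → G ≃ₜ G} {l : ℝ≥0}
    (ha : ∀ n, LipschitzWith l ((a n)⁻¹ : G ≃ₜ G)) (n : ℕ) :
    LipschitzWith (l ^ n) ((compSeq a n)⁻¹ : G ≃ₜ G) := by
  induction n with
  | zero => rw [pow_zero]; exact LipschitzWith.id
  | succ n ih => rw [pow_succ, compSeq, mul_inv_rev]; exact ih.comp (ha n)

theorem compSeq_conj {a c u : ℕ → G ≃ₜ G} (h : ∀ n, a n = u (n + 1) * c n * (u n)⁻¹) (n : ℕ) :
    compSeq a n = u n * compSeq c n * (u 0)⁻¹ := by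
  induction n with
  | zero => simp [compSeq]
  | succ n ih => rw [compSeq, compSeq, ih, h]; group

/-- The sum of a geometric series bounds the distance along a sequence with geometric steps. -/
theorem uniformDist_le_geometric {F : ℕ → G ≃ₜ G} {c s : ℝ≥0} (hs : s < 1)
    (hF : ∀ n, uniformDist (F n) (F (n + 1)) ≤ (c * s ^ n : ℝ≥0)) {n m : ℕ} (hnm : n ≤ m) :
    uniformDist (F n) (F m) ≤ (c / (1 - s) * s ^ n : ℝ≥0) := by
  obtain ⟨k, rfl⟩ := Nat.exists_eq_add_of_le hnm
  clear hnm
  induction k generalizing n with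
  | zero => simp [uniformDist_self]
  | succ k ih =>
    have h1 : (1 - s : ℝ≥0) ≠ 0 := (tsub_pos_of_lt hs).ne'
    have e : c * s ^ n + c / (1 - s) * s ^ (n + 1) = c / (1 - s) * s ^ n := by
      have : c = c / (1 - s) * (1 - s) := (div_mul_cancel₀ c h1).symm
      calc c * s ^ n + c / (1 - s) * s ^ (n + 1)
          = c / (1 - s) * s ^ n * ((1 - s) + s) := by
            nth_rewrite 1 [this]; ring
        _ = _ := by rw [tsub_add_cancel_of_le hs.le, mul_one]
    rw [← e, ENNReal.coe_add, show n + (k + 1) = n + 1 + k by ring]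
    exact (uniformDist_triangle _ _ _).trans (add_le_add (hF n) ih)

/-- If the contraction of the base beats the expansion `l` of the inverse fibre maps, the sequence
`(b_{n-1} ∘ ⋯ ∘ b_0)⁻¹ ∘ (a_{n-1} ∘ ⋯ ∘ a_0)` is Cauchy, with a geometric rate. -/
theorem uniformDist_compSeq_le {a b : ℕ → G ≃ₜ G} {E l c r : ℝ≥0} (hs : l * r < 1)
    (hb : ∀ n, LipschitzWith (E * l ^ n) ((compSeq b (n + 1))⁻¹ : G ≃ₜ G))
    (hab : ∀ n, uniformDist (a n) (b n) ≤ (c * r ^ n : ℝ≥0)) {n m : ℕ} (hnm : n ≤ m) :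
    uniformDist ((compSeq b n)⁻¹ * compSeq a n) ((compSeq b m)⁻¹ * compSeq a m) ≤
      (E * c / (1 - l * r) * (l * r) ^ n : ℝ≥0) := by
  refine uniformDist_le_geometric (F := fun n => (compSeq b n)⁻¹ * compSeq a n) hs (fun n => ?_) hnm
  -- consecutive terms differ by `a n` against `b n`, followed by `(b_n ∘ ⋯ ∘ b_0)⁻¹`
  have e : (compSeq b n)⁻¹ * compSeq a n = (compSeq b (n + 1))⁻¹ * (b n * compSeq a n) := by
    rw [compSeq]; group
  simp only [e]
  calc _ ≤ ((E * l ^ n : ℝ≥0) : ℝ≥0∞) * uniformDist (b n * compSeq a n) (compSeq a (n + 1)) :=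
        uniformDist_mul_left_le_of_lipschitz (hb n) _ _
    _ ≤ ((E * l ^ n : ℝ≥0) : ℝ≥0∞) * (c * r ^ n : ℝ≥0) := by
        rw [compSeq, uniformDist_mul_right, uniformDist_comm]
        gcongr
        exact hab n
    _ = _ := by
        rw [← ENNReal.coe_mul]
        congr 1
        ring

/-- A map approximated at rate `s ^ n` by maps whose Lipschitz constants grow like `L ^ n` is
`γ`-Hölder as soon as `s ≤ (s / L) ^ γ`. -/
theorem holderWith_of_geometric_approx {F : ℕ → G ≃ₜ G} {h : G ≃ₜ G} {D d s L γ : ℝ≥0}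
    (hs0 : 0 < s) (hs : s < 1) (hL : 1 ≤ L) (hD : ∀ p q : G, edist p q ≤ D)
    (hF : ∀ n, LipschitzWith (L ^ n) (F n)) (hlim : ∀ n, uniformDist (F n) h ≤ (d * s ^ n : ℝ≥0))
    (hγ : s ≤ (s / L) ^ (γ : ℝ)) :
    HolderWith (D + (2 * d + 1) / s) γ h := by
  have hL0 : 0 < L := one_pos.trans_le hL
  have hγs : 0 < (s / L) ^ (γ : ℝ) := NNReal.rpow_pos (by positivity)
  intro p q
  rw [edist_nndist, edist_nndist, ← ENNReal.coe_rpow_of_nonneg _ (NNReal.coe_nonneg γ), ← ENNReal.coe_mul,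
    ENNReal.coe_le_coe]
  have hD' : nndist (h p) (h q) ≤ D := by
    have := hD (h p) (h q); rwa [edist_nndist, ENNReal.coe_le_coe] at this
  rcases eq_or_ne p q with rfl | hpq
  · simp
  have ht : 0 < nndist p q := pos_iff_ne_zero.2 (nndist_eq_zero.not.2 hpq)
  rcases le_or_gt 1 (nndist p q) with h1 | h1
  · calc nndist (h p) (h q) ≤ D * 1 := by simpa using hD'
      _ ≤ _ := mul_le_mul' le_self_add (NNReal.one_le_rpow h1 γ.2)
  -- with `t = d(p, q)`, the errors `d s ^ n` and `L ^ n t` balance when `t` is about `(s / L) ^ n`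
  obtain ⟨n, hn, hn'⟩ := exists_nat_pow_near_of_lt_one ht h1.le (y := s / L) (by positivity)
    (by rw [div_lt_one hL0]; exact hs.trans_le hL)
  have hFn : ∀ z, nndist (F n z) (h z) ≤ d * s ^ n := fun z => by
    have := (edist_le_uniformDist (F n) h z).trans (hlim n)
    rwa [edist_nndist, ENNReal.coe_le_coe] at this
  calc nndist (h p) (h q)
      ≤ nndist (h p) (F n p) + nndist (F n p) (F n q) + nndist (F n q) (h q) :=
        (nndist_triangle _ (F n q) _).trans (add_le_add_left (nndist_triangle _ _ _) _)
    _ ≤ d * s ^ n + L ^ n * (s / L) ^ n + d * s ^ n := by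
        rw [nndist_comm]
        exact add_le_add (add_le_add (hFn p) (((hF n).nndist_le p q).trans
          (mul_le_mul_right hn' _))) (hFn q)
    _ = (2 * d + 1) / s * s ^ (n + 1) := by
        rw [← mul_pow, mul_div_cancel₀ _ hL0.ne']
        field_simp
        ring
    _ ≤ (2 * d + 1) / s * ((s / L) ^ (n + 1)) ^ (γ : ℝ) := by
        rw [← NNReal.rpow_natCast (s / L), ← NNReal.rpow_mul, mul_comm _ (γ : ℝ), NNReal.rpow_mul,
          NNReal.rpow_natCast]
        gcongr
    _ ≤ _ := by gcongr; exact le_add_self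

/-- Limits of `(b_{n-1} ∘ ⋯ ∘ b_0)⁻¹ ∘ (a_{n-1} ∘ ⋯ ∘ a_0)` exist and are Hölder, with exponent and
constant that depend only on the bounds for the sequences. -/
theorem exists_holder_limit_compSeq [CompactSpace G] {l r α : ℝ≥0} (C : ℝ≥0) (hr : 0 < r)
    (hl : 1 ≤ l) (hs : l * r < 1) (hα : 0 < α) :
    ∃ γ : ℝ≥0, 0 < γ ∧ γ < α ∧ ∃ C' : ℝ≥0, ∀ a b : ℕ → G ≃ₜ G,
      (∀ n, LipschitzWith l (a n)) → (∀ n, LipschitzWith l ((a n)⁻¹ : G ≃ₜ G)) →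
      (∀ n, LipschitzWith l ((b n)⁻¹ : G ≃ₜ G)) →
      (∀ n, uniformDist (a n) (b n) ≤ (C * r ^ n : ℝ≥0)) →
      ∃ h : G ≃ₜ G,
        Tendsto (fun n => uniformDist ((compSeq b n)⁻¹ * compSeq a n) h) atTop (𝓝 0) ∧
          HolderWith C' γ h := by
  have hl0 : 0 < l := one_pos.trans_le hl
  have hs0 : 0 < l * r := by positivity
  have hκ0 : 0 < l * r / l ^ 2 := by positivity
  -- a small exponent works, since `κ ^ γ → 1` as `γ → 0` while `l * r < 1`
  obtain ⟨γ, hγ0, hγα, hγ⟩ : ∃ γ : ℝ≥0, 0 < γ ∧ γ < α ∧ l * r ≤ (l * r / l ^ 2) ^ (γ : ℝ) := by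
    have ht : Tendsto (fun γ : ℝ≥0 => (l * r / l ^ 2) ^ (γ : ℝ)) (𝓝[>] 0) (𝓝 1) := by
      have hc : Tendsto (fun γ : ℝ≥0 => (l * r / l ^ 2) ^ (γ : ℝ)) (𝓝 0)
          (𝓝 ((l * r / l ^ 2) ^ ((0 : ℝ≥0) : ℝ))) :=
        (NNReal.continuousAt_rpow (Or.inl hκ0.ne')).tendsto.comp
          (tendsto_const_nhds.prodMk_nhds NNReal.continuous_coe.continuousAt)
      simpa using hc.mono_left nhdsWithin_le_nhds
    obtain ⟨γ, h1, h2, h3⟩ := ((ht.eventually (lt_mem_nhds hs)).and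
      ((Ioo_mem_nhdsGT hα : Set.Ioo 0 α ∈ 𝓝[>] 0))).exists
    exact ⟨γ, h2, h3, h1.le⟩
  obtain ⟨D, hD⟩ := exists_edist_le G
  refine ⟨γ, hγ0, hγα, D + (2 * (l * C / (1 - l * r)) + 1) / (l * r), fun a b ha ha' hb' hab => ?_⟩
  have hτ : Tendsto (fun n => ((l * C / (1 - l * r) * (l * r) ^ n : ℝ≥0) : ℝ≥0∞)) atTop (𝓝 0) := by
    rw [← ENNReal.coe_zero, ENNReal.tendsto_coe, ← mul_zero (l * C / (1 - l * r))]
    exact (NNReal.tendsto_pow_atTop_nhds_zero_of_lt_one hs).const_mul _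
  have hstep : ∀ c : ℕ → G ≃ₜ G, (∀ n, LipschitzWith l ((c n)⁻¹ : G ≃ₜ G)) →
      ∀ n, LipschitzWith (l * l ^ n) ((compSeq c (n + 1))⁻¹ : G ≃ₜ G) := fun c hc n => by
    rw [← pow_succ']; exact lipschitzWith_compSeq_inv hc (n + 1)
  obtain ⟨h, hh, -⟩ := exists_uniform_limit
    (h := fun n => (compSeq b n)⁻¹ * compSeq a n) hτ hτ
    (fun n m hnm => uniformDist_compSeq_le hs (hstep b hb') hab hnm)
    (fun n m hnm => by
      simp only [mul_inv_rev, inv_inv]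
      exact uniformDist_compSeq_le hs (hstep a ha')
        (fun n => (uniformDist_comm _ _).trans_le (hab n)) hnm)
  refine ⟨h, tendsto_of_tendsto_of_tendsto_of_le_of_le tendsto_const_nhds hτ
    (fun _ => zero_le) hh, ?_⟩
  refine holderWith_of_geometric_approx (L := l ^ 2) hs0 hs (one_le_pow₀ hl) hD (fun n => ?_) hh hγ
  rw [pow_two, mul_pow]
  exact (lipschitzWith_compSeq_inv hb' n).comp (lipschitzWith_compSeq ha n)

/-- Conjugate sequences: `a_n = u_{n+1} ∘ c_n ∘ u_n⁻¹` and `b_n = v_{n+1} ∘ d_n ∘ v_n⁻¹`. If `u_n`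
and `v_n` come arbitrarily close, then the distance of `u_0` and `v_0` is controlled by how far
the holonomies of `a, b` and of `c, d` are from the identity. -/
theorem uniformDist_le_of_conj {a b c d u v : ℕ → G ≃ₜ G} {l r C K M β : ℝ≥0} (hr : r < 1)
    (hs : l * r < 1) (hβ : 0 < β)
    (ha : ∀ n, a n = u (n + 1) * c n * (u n)⁻¹) (hb : ∀ n, b n = v (n + 1) * d n * (v n)⁻¹)
    (hbl : ∀ n, LipschitzWith l ((b n)⁻¹ : G ≃ₜ G))
    (hdK : ∀ n, LipschitzWith K ((compSeq d n)⁻¹ : G ≃ₜ G))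
    (hab : ∀ n, uniformDist (a n) (b n) ≤ (C * r ^ n : ℝ≥0))
    (hcd : ∀ n, uniformDist (c n) (d n) ≤ (C * r ^ n : ℝ≥0))
    (hv : HolderWith M β (v 0)) (hv' : ∀ n, HolderWith M β ((v n)⁻¹ : G ≃ₜ G))
    (huv : ∀ ε : ℝ≥0∞, 0 < ε → ∃ n, uniformDist (u n) (v n) < ε) :
    uniformDist (u 0) (v 0) ≤
      (l * C / (1 - l * r) + M * (K * C / (1 - r)) ^ (β : ℝ) : ℝ≥0) := by
  set Df : ℝ≥0 := l * C / (1 - l * r)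
  set Dg : ℝ≥0 := K * C / (1 - r)
  have hDf : ∀ n, uniformDist ((compSeq b n)⁻¹ * compSeq a n) 1 ≤ Df := fun n => by
    have := uniformDist_compSeq_le (E := l) hs
      (fun n => by rw [← pow_succ']; exact lipschitzWith_compSeq_inv hbl (n + 1)) hab (zero_le (a := n))
    simpa [compSeq, uniformDist_comm 1] using this
  have hDg : ∀ n, uniformDist ((compSeq d n)⁻¹ * compSeq c n) 1 ≤ Dg := fun n => by
    have := uniformDist_compSeq_le (E := K) (l := 1) (by simpa using hr)
      (fun n => by simpa using hdK (n + 1)) hcd (zero_le (a := n))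
    simpa [compSeq, uniformDist_comm 1] using this
  have key : ∀ ε : ℝ≥0∞, 0 < ε → uniformDist (u 0) (v 0) ≤
      Df + M * (K * (M * ε ^ (β : ℝ)) + Dg) ^ (β : ℝ) := by
    intro ε hε
    obtain ⟨n, hn⟩ := huv ε hε
    set X := (compSeq d n)⁻¹ * ((v n)⁻¹ * u n * compSeq c n) with hX
    have e : (compSeq b n)⁻¹ * compSeq a n * u 0 = v 0 * X := by
      rw [compSeq_conj ha, compSeq_conj hb, hX]; group
    have h1 : uniformDist (u 0) (v 0 * X) ≤ Df := by
      rw [← e, uniformDist_comm]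
      have := hDf n
      rwa [← uniformDist_mul_right _ _ (u 0), one_mul] at this
    -- `X` differs from the holonomy of `c, d` only by the factor `v_n⁻¹ ∘ u_n`
    have h2 : uniformDist X 1 ≤ K * (M * ε ^ (β : ℝ)) + Dg := by
      refine (uniformDist_triangle _ ((compSeq d n)⁻¹ * compSeq c n) _).trans
        (add_le_add ?_ (hDg n))
      refine (uniformDist_mul_left_le_of_lipschitz (hdK n) _ _).trans ?_
      gcongr
      rw [← one_mul (compSeq c n), ← mul_assoc _ 1, uniformDist_mul_right, mul_one,
        ← inv_mul_cancel (v n)]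
      refine (uniformDist_mul_left_le (hv' n) _ _).trans ?_
      gcongr
    refine (uniformDist_triangle _ (v 0 * X) _).trans (add_le_add h1 ?_)
    have := uniformDist_mul_left_le hv X 1
    rw [mul_one] at this
    refine this.trans ?_
    gcongr
  have hc : Continuous fun ε : ℝ≥0∞ => (Df : ℝ≥0∞) + M * (K * (M * ε ^ (β : ℝ)) + Dg) ^ (β : ℝ) :=
    continuous_const.add <| (ENNReal.continuous_const_mul ENNReal.coe_ne_top).comp <|
      ENNReal.continuous_rpow_const.comp <| Continuous.add ((ENNReal.continuous_const_mul
        ENNReal.coe_ne_top).comp ((ENNReal.continuous_const_mul ENNReal.coe_ne_top).comp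
          ENNReal.continuous_rpow_const)) continuous_const
  have ht := (hc.tendsto 0).mono_left (nhdsWithin_le_nhds (s := Set.Ioi 0))
  have := ge_of_tendsto ht (eventually_mem_nhdsWithin.mono key)
  rw [ENNReal.zero_rpow_of_pos (by exact_mod_cast hβ)] at this
  simpa [ENNReal.coe_rpow_of_nonneg] using this

end Sequences

/-! ### Cylinders and iterates on the subshift -/

section Subshift

variable {k : ℕ} {P : Matrix (Fin k) (Fin k) ℕ}

/-- The points `x` and `y` have the same coordinates `n` with `|n| < N`. -/
def Agree (N : ℕ) (x y : Subshift P) : Prop := ∀ n : ℤ, |n| < (N : ℤ) → x.1 n = y.1 n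

theorem agree_zero (x y : Subshift P) : Agree 0 x y :=
  fun n hn => absurd hn (by simp)

theorem Agree.symm {N : ℕ} {x y : Subshift P} (h : Agree N x y) : Agree N y x :=
  fun n hn => (h n hn).symm

theorem Agree.trans {N : ℕ} {x y z : Subshift P} (h : Agree N x y) (h' : Agree N y z) :
    Agree N x z :=
  fun n hn => (h n hn).trans (h' n hn)

theorem Agree.mono {N M : ℕ} {x y : Subshift P} (h : Agree N x y) (hM : M ≤ N) : Agree M x y :=
  fun n hn => h n (hn.trans_le (by exact_mod_cast hM))

theorem eq_of_forall_agree {x y : Subshift P} (h : ∀ N, Agree N x y) : x = y :=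
  Subtype.ext <| funext fun n => h (n.natAbs + 1) n (by rw [Int.abs_eq_natAbs]; omega)

theorem shift_iterate_apply (n : ℕ) (x : Subshift P) (m : ℤ) :
    ((shift P)^[n] x).1 m = x.1 (m + n) := by
  induction n generalizing x with
  | zero => simp
  | succ n ih =>
    rw [Function.iterate_succ_apply, ih]
    exact congrArg x.1 (by push_cast; ring)

theorem shift_symm_iterate_apply (n : ℕ) (x : Subshift P) (m : ℤ) :
    ((shift P).symm^[n] x).1 m = x.1 (m - n) := by
  induction n generalizing x with
  | zero => simp
  | succ n ih =>
    rw [Function.iterate_succ_apply, ih]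
    exact congrArg x.1 (by push_cast; ring)

theorem agree_iterate_shift {N : ℕ} {x y : Subshift P} (h : y ∈ localStable x) (hN : Agree N x y)
    (n : ℕ) : Agree (N + n) ((shift P)^[n] x) ((shift P)^[n] y) := by
  intro m hm
  rw [shift_iterate_apply, shift_iterate_apply]
  rcases le_or_gt 0 (m + n) with h0 | h0
  · exact h _ h0
  · exact hN _ (by rw [abs_lt] at hm ⊢; push_cast at hm; omega)

theorem agree_iterate_shift_symm {N : ℕ} {x y : Subshift P} (h : y ∈ localUnstable x)
    (hN : Agree N x y) (n : ℕ) :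
    Agree (N + n) ((shift P).symm^[n] x) ((shift P).symm^[n] y) := by
  intro m hm
  rw [shift_symm_iterate_apply, shift_symm_iterate_apply]
  rcases le_or_gt (m - n) 0 with h0 | h0
  · exact h _ h0
  · exact hN _ (by rw [abs_lt] at hm ⊢; push_cast at hm; omega)

theorem bddAbove_agree {x y : Subshift P} (hxy : x ≠ y) : BddAbove {N : ℕ | Agree N x y} := by
  obtain ⟨M, hM⟩ : ∃ M, ¬ Agree M x y := by
    by_contra! hc
    exact hxy (eq_of_forall_agree hc)
  exact ⟨M, fun N hN => not_lt.1 fun hlt => hM (hN.mono hlt.le)⟩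

theorem shiftDist_le {ρ : ℝ} (hρ : 1 < ρ) {N : ℕ} {x y : Subshift P} (h : Agree N x y) :
    shiftDist ρ x y ≤ (ρ ^ N)⁻¹ := by
  have h0 : 0 < ρ := one_pos.trans hρ
  rw [shiftDist]
  split_ifs with hxy
  · positivity
  · gcongr
    · exact hρ.le
    · exact le_csSup (bddAbove_agree hxy) h

theorem exists_agree_shiftDist (ρ : ℝ) {x y : Subshift P} (hxy : x ≠ y) :
    ∃ N, Agree N x y ∧ shiftDist ρ x y = (ρ ^ N)⁻¹ := by
  have hm : sSup {N : ℕ | Agree N x y} ∈ {N : ℕ | Agree N x y} :=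
    Nat.sSup_mem ⟨0, agree_zero x y⟩ (bddAbove_agree hxy)
  exact ⟨_, hm, by rw [shiftDist, if_neg hxy]; rfl⟩

theorem isClosed_subshift (P : Matrix (Fin k) (Fin k) ℕ) :
    IsClosed {x : ℤ → Fin k | ∀ n : ℤ, P (x n) (x (n + 1)) = 1} := by
  rw [Set.ofPred_forall]
  refine isClosed_iInter fun n => ?_
  have hc : Continuous fun x : ℤ → Fin k => (x n, x (n + 1)) :=
    (continuous_apply n).prodMk (continuous_apply (n + 1))
  exact (isClosed_discrete {p : Fin k × Fin k | P p.1 p.2 = 1}).preimage hc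

instance : CompactSpace (Subshift P) :=
  isCompact_iff_compactSpace.1 (isClosed_subshift P).isCompact

instance : T2Space (Subshift P) := inferInstanceAs (T2Space {_x : ℤ → Fin k // _})

instance : SecondCountableTopology (Subshift P) :=
  TopologicalSpace.Subtype.secondCountableTopology
    {x : ℤ → Fin k | ∀ n : ℤ, P (x n) (x (n + 1)) = 1}

instance : TopologicalSpace.MetrizableSpace (Subshift P) :=
  TopologicalSpace.metrizableSpace_of_t3_secondCountable _

instance : BorelSpace (Subshift P) :=
  inferInstanceAs (BorelSpace {_x : ℤ → Fin k // _})

theorem continuous_coord (n : ℤ) : Continuous fun x : Subshift P => x.1 n :=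
  (continuous_apply n).comp continuous_subtype_val

theorem isOpen_agree (N : ℕ) (x : Subshift P) : IsOpen {y | Agree N x y} := by
  have : {y | Agree N x y} = ⋂ n ∈ {n : ℤ | |n| < (N : ℤ)}, {y : Subshift P | x.1 n = y.1 n} := by
    ext y; simp [Agree]
  rw [this]
  refine Set.Finite.isOpen_biInter ?_ fun n _ => ?_
  · refine (Set.finite_Icc (-(N : ℤ)) N).subset fun n hn => ?_
    have : |n| < (N : ℤ) := hn
    rw [abs_lt] at this
    exact ⟨by omega, by omega⟩
  · exact (isOpen_discrete {i : Fin k | x.1 n = i}).preimage (continuous_coord n)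

/-- The sets of points that agree with `x` up to some order form a neighbourhood basis. -/
theorem exists_agree_subset {x : Subshift P} {U : Set (Subshift P)} (hU : U ∈ 𝓝 x) :
    ∃ N, ∀ y, Agree N x y → y ∈ U := by
  by_contra! hc
  choose y hy hyU using hc
  have : Tendsto y atTop (𝓝 x) := by
    refine tendsto_subtype_rng.2 (tendsto_pi_nhds.2 fun n => ?_)
    refine tendsto_const_nhds.congr' ?_
    filter_upwards [eventually_gt_atTop n.natAbs] with N hN
    exact hy N n (by rw [Int.abs_eq_natAbs]; omega)
  obtain ⟨N, hN⟩ := (this.eventually hU).exists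
  exact hyU N hN

theorem continuous_shift : Continuous (shift P) :=
  continuous_induced_rng.2 (continuous_pi fun n => continuous_coord (n + 1))

theorem continuous_shift_symm : Continuous (shift P).symm :=
  continuous_induced_rng.2 (continuous_pi fun n => continuous_coord (n - 1))

theorem measurePreserving_shift_symm {μ : Measure (Subshift P)}
    (h : MeasurePreserving (shift P) μ μ) : MeasurePreserving (shift P).symm μ μ := by
  let e : Subshift P ≃ᵐ Subshift P :=
    { shift P with
      measurable_toFun := continuous_shift.measurable
      measurable_invFun := continuous_shift_symm.measurable }
  exact MeasurePreserving.symm e h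

end Subshift

section Iterates

variable {k : ℕ} {P : Matrix (Fin k) (Fin k) ℕ} {G : Type*} [MetricSpace G]

theorem iter_eq_compSeq (f : Subshift P → G ≃ₜ G) (n : ℕ) (x : Subshift P) :
    iter f n x = compSeq (fun j => f ((shift P)^[j] x)) n := by
  induction n with
  | zero => rfl
  | succ n ih => rw [iter, compSeq, ih]

theorem iter_succ' (f : Subshift P → G ≃ₜ G) (n : ℕ) (x : Subshift P) :
    iter f (n + 1) x = iter f n (shift P x) * f x := by
  induction n with
  | zero => simp [iter]
  | succ n ih => rw [iter, ih, iter, Function.iterate_succ_apply, mul_assoc]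

theorem backIter_eq_compSeq (f : Subshift P → G ≃ₜ G) (n : ℕ) (x : Subshift P) :
    backIter f n x = compSeq (fun j => (f ((shift P).symm^[j + 1] x))⁻¹) n := by
  induction n with
  | zero => simp [backIter, iter, compSeq]
  | succ n ih =>
    rw [compSeq, ← ih, backIter, backIter, iter_succ', Function.iterate_succ_apply' _ n,
      Equiv.apply_symm_apply, mul_inv_rev]

end Iterates

/-! ### Common returns of asymptotic orbits -/

section CommonReturns

variable {k : ℕ} {P : Matrix (Fin k) (Fin k) ℕ} {Y : Type*} [PseudoEMetricSpace Y]
  [TopologicalSpace.SeparableSpace Y] [Nonempty Y] {μ : Measure (Subshift P)} [IsFiniteMeasure μ]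

/-- Lusin's theorem: off a set of small measure, a measurable map to a separable metric space
oscillates little on the cylinders of some fixed length. -/
theorem exists_measurableSet_agree_edist_lt {Φ : Subshift P → Y}
    (hΦ : ∀ (y : Y) (ε : ℝ≥0∞), NullMeasurableSet {x | edist (Φ x) y < ε} μ)
    {ε δ : ℝ≥0∞} (hε : 0 < ε) (hδ : 0 < δ) :
    ∃ (K : Set (Subshift P)) (N : ℕ), MeasurableSet K ∧ μ Kᶜ ≤ δ ∧
      ∀ x ∈ K, ∀ y ∈ K, Agree N x y → edist (Φ x) (Φ y) < ε := by
  have hε2 : 0 < ε / 2 := ENNReal.half_pos hε.ne'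
  have hδ2 : 0 < δ / 2 := ENNReal.half_pos hδ.ne'
  let s := TopologicalSpace.denseSeq Y
  choose B hBA hBm hBae using fun i => (hΦ (s i) (ε / 2)).exists_measurable_subset_ae_eq
  let D := disjointed B
  have hDm : ∀ i, MeasurableSet (D i) := fun i => MeasurableSet.disjointed hBm i
  have hDnull : μ (⋃ i, D i)ᶜ = 0 := by
    rw [iUnion_disjointed]
    have hall : ∀ᵐ x ∂μ, ∀ i, (x ∈ B i ↔ edist (Φ x) (s i) < ε / 2) :=
      ae_all_iff.2 fun i => (hBae i).mem_iff
    refine measure_mono_null (fun x hx => show ¬ _ from fun hx' => ?_) (ae_iff.1 hall)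
    obtain ⟨i, hi⟩ := (TopologicalSpace.denseRange_denseSeq Y).exists_mem_open
      (Metric.isOpen_eball (x := Φ x) (ε := ε / 2)) ⟨Φ x, Metric.mem_eball_self hε2⟩
    refine hx (Set.mem_iUnion.2 ⟨i, (hx' i).2 ?_⟩)
    rw [edist_comm]
    exact hi
  obtain ⟨η, hη, hηsum⟩ := ENNReal.exists_pos_sum_of_countable' hδ2.ne' ℕ
  choose F hFD hFc hFμ using fun i =>
    (hDm i).exists_isClosed_sdiff_lt (measure_ne_top μ _) (hη i).ne'
  have hFdisj : ∀ i j x, x ∈ F i → x ∈ F j → i = j := fun i j x hi hj => by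
    by_contra hij
    exact Set.disjoint_left.1 (disjoint_disjointed B hij) (hFD i hi) (hFD j hj)
  have hFμ' : μ (⋃ i, F i)ᶜ < δ := by
    have hsub : (⋃ i, F i)ᶜ ⊆ (⋃ i, D i)ᶜ ∪ ⋃ i, D i \ F i := by
      intro x hx
      by_cases hxD : x ∈ ⋃ i, D i
      · obtain ⟨i, hi⟩ := Set.mem_iUnion.1 hxD
        exact Or.inr (Set.mem_iUnion.2 ⟨i, hi, fun h => hx (Set.mem_iUnion.2 ⟨i, h⟩)⟩)
      · exact Or.inl hxD
    calc μ (⋃ i, F i)ᶜ ≤ μ (⋃ i, D i)ᶜ + ∑' i, μ (D i \ F i) :=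
          (measure_mono hsub).trans ((measure_union_le _ _).trans (by
            gcongr; exact measure_iUnion_le _))
      _ ≤ 0 + ∑' i, η i := add_le_add hDnull.le (ENNReal.tsum_le_tsum fun i => (hFμ i).le)
      _ < δ / 2 := by rwa [zero_add]
      _ ≤ δ := ENNReal.half_le_self
  have hlim : Tendsto (fun n => μ (⋃ i < n, F i)ᶜ) atTop (𝓝 (μ (⋃ i, F i)ᶜ)) := by
    have e : (⋃ i, F i)ᶜ = ⋂ n, (⋃ i < n, F i)ᶜ := by
      ext x
      simp only [Set.mem_compl_iff, Set.mem_iUnion, Set.mem_iInter, not_exists]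
      exact ⟨fun h n i _ => h i, fun h i => h (i + 1) i (Nat.lt_succ_self i)⟩
    rw [e]
    refine tendsto_measure_iInter_atTop (fun n => ?_) (fun n m hnm => ?_)
      ⟨0, measure_ne_top μ _⟩
    · exact (MeasurableSet.biUnion (Set.to_countable _)
        fun i _ => (hFc i).measurableSet).compl.nullMeasurableSet
    · exact Set.compl_subset_compl.2 (Set.biUnion_subset_biUnion_left fun i hi => lt_of_lt_of_le hi hnm)
  obtain ⟨n, hn⟩ := (hlim.eventually (gt_mem_nhds hFμ')).exists
  set K : Set (Subshift P) := ⋃ i < n, F i with hK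
  have hKc : IsClosed K := (Set.finite_lt_nat n).isClosed_biUnion fun i _ => hFc i
  -- a whole cylinder around `x` avoids those of the finitely many closed pieces that miss `x`
  have hloc : ∀ x : Subshift P, ∃ N, ∀ y, Agree N x y → ∀ i < n, y ∈ F i → x ∈ F i := by
    intro x
    have hU : (⋃ i ∈ {i | i < n ∧ x ∉ F i}, F i)ᶜ ∈ 𝓝 x := by
      refine IsOpen.mem_nhds (Set.Finite.isClosed_biUnion ?_ fun i _ => hFc i).isOpen_compl ?_
      · exact (Set.finite_lt_nat n).subset fun i hi => hi.1
      · simp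
    obtain ⟨N, hN⟩ := exists_agree_subset hU
    refine ⟨N, fun y hy i hi hyi => by_contra fun hxi => hN y hy ?_⟩
    exact Set.mem_biUnion (show i ∈ {i | i < n ∧ x ∉ F i} from ⟨hi, hxi⟩) hyi
  choose N hN using hloc
  obtain ⟨t, -, ht⟩ := hKc.isCompact.elim_nhds_subcover (fun x => {y | Agree (N x) x y})
    fun x _ => (isOpen_agree (N x) x).mem_nhds fun _ _ => rfl
  refine ⟨K, t.sup N, hKc.measurableSet, hn.le, fun y hy z hz hyz => ?_⟩
  obtain ⟨x, hx, hxy⟩ := Set.mem_iUnion₂.1 (ht hy)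
  have hxz : Agree (N x) x z := Agree.trans hxy (hyz.mono (Finset.le_sup hx))
  obtain ⟨i, hi, hyi⟩ := Set.mem_iUnion₂.1 hy
  obtain ⟨j, hj, hzj⟩ := Set.mem_iUnion₂.1 hz
  obtain rfl := hFdisj i j x (hN x y hxy i hi hyi) (hN x z hxz j hj hzj)
  have h1 : edist (Φ y) (s i) < ε / 2 := hBA i (disjointed_subset B i (hFD i hyi))
  have h2 : edist (Φ z) (s i) < ε / 2 := hBA i (disjointed_subset B i (hFD i hzj))
  calc edist (Φ y) (Φ z) ≤ edist (Φ y) (s i) + edist (Φ z) (s i) := edist_triangle_right _ _ _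
    _ < ε / 2 + ε / 2 := ENNReal.add_lt_add h1 h2
    _ = ε := ENNReal.add_halves ε

/-- Almost all pairs of asymptotic points have, along their orbits, values of `Φ` that are
arbitrarily close. By Lusin's theorem `Φ` has small oscillation off sets of summable measure, and by
the Borel-Cantelli lemma, at suitably chosen times, almost every orbit eventually avoids them. -/
theorem exists_ae_edist_iterate_lt {Φ : Subshift P → Y}
    (hΦ : ∀ (y : Y) (ε : ℝ≥0∞), NullMeasurableSet {x | edist (Φ x) y < ε} μ)
    {T : Subshift P → Subshift P} (hT : MeasurePreserving T μ μ) :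
    ∃ S : Set (Subshift P), (∀ᵐ x ∂μ, x ∈ S) ∧ ∀ x ∈ S, ∀ y ∈ S,
      (∀ n, Agree n (T^[n] x) (T^[n] y)) →
        ∀ ε : ℝ≥0∞, 0 < ε → ∃ n, edist (Φ (T^[n] x)) (Φ (T^[n] y)) < ε := by
  obtain ⟨δ, hδ, hδsum⟩ := ENNReal.exists_pos_sum_of_countable' one_ne_zero ℕ
  choose K N hKm hKμ hK using fun m : ℕ => exists_measurableSet_agree_edist_lt hΦ
    (ENNReal.inv_pos.2 (ENNReal.natCast_ne_top m)) (hδ m)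
  refine ⟨{x | ∀ᶠ m in atTop, T^[N m] x ∈ K m}, ?_, fun x hx y hy hxy ε hε => ?_⟩
  · have hsum : ∑' m, μ (T^[N m] ⁻¹' (K m)ᶜ) ≠ ∞ := by
      refine ne_top_of_le_ne_top (hδsum.trans ENNReal.one_lt_top).ne
        (ENNReal.tsum_le_tsum fun m => ?_)
      rw [(hT.iterate (N m)).measure_preimage (hKm m).compl.nullMeasurableSet]
      exact hKμ m
    filter_upwards [ae_eventually_notMem hsum] with x hx
    exact hx.mono fun m hm => not_not.1 hm
  · obtain ⟨m, ⟨hm1, hm2⟩, hm3⟩ := ((Eventually.and hx hy).and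
      (ENNReal.tendsto_inv_nat_nhds_zero.eventually (gt_mem_nhds hε))).exists
    exact ⟨N m, (hK m _ hm1 _ hm2 (hxy (N m))).trans hm3⟩

end CommonReturns

/-! ### Local product structure -/

section ProductStructure

variable {k : ℕ} {P : Matrix (Fin k) (Fin k) ℕ} {μ : Measure (Subshift P)}

theorem measurable_past : Measurable (past : Subshift P → ℕ → Fin k) :=
  measurable_pi_iff.2 fun n => (continuous_coord (-(n : ℤ))).measurable

theorem measurable_future : Measurable (future : Subshift P → ℕ → Fin k) :=
  measurable_pi_iff.2 fun n => (continuous_coord (n : ℤ)).measurable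

theorem measurable_glue : Measurable (glue : (ℕ → Fin k) × (ℕ → Fin k) → ℤ → Fin k) := by
  refine measurable_pi_iff.2 fun n => ?_
  by_cases hn : 0 ≤ n
  · simp only [glue, hn, if_true]
    exact (measurable_pi_apply _).comp measurable_snd
  · simp only [glue, hn, if_false]
    exact (measurable_pi_apply _).comp measurable_fst

theorem measurableEmbedding_val :
    MeasurableEmbedding fun x : Subshift P => x.1 :=
  MeasurableEmbedding.subtype_coe (isClosed_subshift P).measurableSet

/-- With local product structure, the bracket of almost every pair of points of a common cylinder
`[0; i]` (the past of the first, the future of the second) lies in a given set of full measure. -/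
theorem HasLocalProductStructure.ae_bracket [IsProbabilityMeasure μ]
    (hμ : HasLocalProductStructure μ) {S : Set (Subshift P)} (hS : ∀ᵐ x ∂μ, x ∈ S) :
    ∀ᵐ p ∂μ.prod μ, p.1.1 0 = p.2.1 0 → ∃ z ∈ S, z ∈ localUnstable p.1 ∧ z ∈ localStable p.2 := by
  obtain ⟨ξ, hξc, hξpos, hξ⟩ := hμ
  -- only the lower bound of the density matters: null sets of `μ` are null for the product
  obtain ⟨c, hc, hcξ⟩ : ∃ c, 0 < c ∧ ∀ x, c ≤ ξ x := by
    rcases isEmpty_or_nonempty (Subshift P) with he | hne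
    · exact ⟨1, one_pos, fun x => he.elim x⟩
    · obtain ⟨x, -, hx⟩ := isCompact_univ.exists_isMinOn Set.univ_nonempty hξc.continuousOn
      exact ⟨ξ x, hξpos x, fun y => hx (Set.mem_univ y)⟩
  set N := toMeasurable μ Sᶜ with hN
  have hN0 : μ N = 0 := by rw [hN, measure_toMeasurable]; exact hS
  have hNm : MeasurableSet N := measurableSet_toMeasurable μ _
  have hcyl : ∀ i, MeasurableSet (cylinder P i) := fun i =>
    ((isClosed_discrete {i}).preimage (continuous_coord 0)).measurableSet
  let B : Fin k → Set ((ℕ → Fin k) × (ℕ → Fin k)) := fun i =>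
    {p | p.1 0 = i ∧ glue p ∈ (fun x : Subshift P => x.1) '' (N ∩ cylinder P i)}
  have hBm : ∀ i, MeasurableSet (B i) := fun i => by
    refine MeasurableSet.inter ?_ (measurable_glue
      (measurableEmbedding_val.measurableSet_image.2 (hNm.inter (hcyl i))))
    exact measurableSet_eq_fun ((measurable_pi_apply 0).comp measurable_fst) measurable_const
  have hB0 : ∀ i, ((μ.map past).prod (μ.map future)) (B i) = 0 := by
    intro i
    have h1 := hξ i (N ∩ cylinder P i) (hNm.inter (hcyl i)) Set.inter_subset_right
    rw [measure_mono_null Set.inter_subset_left hN0] at h1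
    have h2 : ENNReal.ofReal c * ((μ.map past).prod (μ.map future)) (B i) ≤ 0 := by
      rw [← lintegral_indicator_const (hBm i), h1]
      refine lintegral_mono fun p => ?_
      by_cases hp : p ∈ B i
      swap
      · rw [Set.indicator_of_notMem hp]
        exact zero_le
      rw [Set.indicator_of_mem hp]
      obtain ⟨hp0, z, ⟨hzN, hzi⟩, hz⟩ := hp
      have hzi' : z.1 0 = i := hzi
      have hz' : z.1 = glue p := hz
      have hpast : past z = p.1 := by
        funext n
        rcases Nat.eq_zero_or_pos n with rfl | hn
        · simp [past, hzi', hp0]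
        · simp [past, hz', glue, hn.ne']
      have hfuture : future z = p.2 := by
        funext n
        simp [future, hz', glue]
      have hmem : p ∈ (past '' cylinder P i) ×ˢ (future '' cylinder P i) :=
        ⟨⟨z, hzi, hpast⟩, ⟨z, hzi, hfuture⟩⟩
      have hj : join i ⟨p, hmem⟩ = z := Subtype.ext hz.symm
      rw [dif_pos hmem, hj, Set.indicator_of_mem (Set.mem_inter hzN hzi)]
      exact ENNReal.ofReal_le_ofReal (hcξ z)
    have h3 : ENNReal.ofReal c ≠ 0 := by simpa using hc
    exact (mul_eq_zero.1 (le_antisymm h2 zero_le)).resolve_left h3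
  have hB : ∀ᵐ p ∂μ.prod μ, ∀ i, Prod.map past future p ∉ B i := by
    refine ae_all_iff.2 fun i => ?_
    have := hB0 i
    rw [Measure.map_prod_map _ _ measurable_past measurable_future, Measure.map_apply
      (measurable_past.prodMap measurable_future) (hBm i)] at this
    exact measure_eq_zero_iff_ae_notMem.1 this
  filter_upwards [hB] with p hp h0
  have hmem : Prod.map past future p ∈
      (past '' cylinder P (p.1.1 0)) ×ˢ (future '' cylinder P (p.1.1 0)) :=
    ⟨⟨p.1, rfl, rfl⟩, ⟨p.2, h0.symm, rfl⟩⟩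
  have hstable : join (p.1.1 0) ⟨_, hmem⟩ ∈ localStable p.2 := fun n hn => by
    simp [join, glue, future, hn]
  have hunstable : join (p.1.1 0) ⟨_, hmem⟩ ∈ localUnstable p.1 := fun n hn => by
    rcases hn.lt_or_eq with hn | rfl
    · simp [join, glue, past, not_le.2 hn, max_eq_left (neg_nonneg.2 hn.le)]
    · exact h0.trans (hstable 0 le_rfl)
  refine ⟨join (p.1.1 0) ⟨_, hmem⟩, by_contra fun hS' => ?_, hunstable, hstable⟩
  refine hp (p.1.1 0) ⟨by simp [past], _, ⟨subset_toMeasurable μ _ hS', ?_⟩, rfl⟩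
  exact (hunstable 0 le_rfl).symm

end ProductStructure

/-! ### Hölder families of homeomorphisms -/

section Extension

variable {k : ℕ} {P : Matrix (Fin k) (Fin k) ℕ} {G : Type*} [MetricSpace G]

/-- Values of `h` at points of `S` that agree to order `N` are `E q ^ N`-close, for every `N`. For
`q = ρ ^ (-η)` this is `η`-Hölder continuity on `S`, without powers of the distance. -/
def GeomHolderOn (E q : ℝ≥0) (h : Subshift P → G ≃ₜ G) (S : Set (Subshift P)) : Prop :=
  ∀ x ∈ S, ∀ y ∈ S, ∀ N, Agree N x y → uniformDist (h x) (h y) ≤ (E * q ^ N : ℝ≥0)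

theorem GeomHolderOn.mono {E E' q : ℝ≥0} {h : Subshift P → G ≃ₜ G} {S : Set (Subshift P)}
    (hh : GeomHolderOn E q h S) (hE : E ≤ E') : GeomHolderOn E' q h S :=
  fun x hx y hy N hN => (hh x hx y hy N hN).trans (by gcongr)

theorem tendsto_geom {E q : ℝ≥0} (hq : q < 1) :
    Tendsto (fun n => ((E * q ^ n : ℝ≥0) : ℝ≥0∞)) atTop (𝓝 0) := by
  rw [← ENNReal.coe_zero, ENNReal.tendsto_coe, ← mul_zero E]
  exact (NNReal.tendsto_pow_atTop_nhds_zero_of_lt_one hq).const_mul _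

theorem eq_of_uniformDist_eq_zero {h h' : G ≃ₜ G} (H : uniformDist h h' = 0) : h = h' :=
  Homeomorph.ext fun p => edist_eq_zero.1 (le_antisymm
    ((edist_le_uniformDist h h' p).trans_eq H) zero_le)

/-- A uniformly Hölder family of homeomorphisms defines a continuous map of the total space. -/
theorem GeomHolderOn.continuous_uncurry [CompactSpace G] {E q : ℝ≥0} {h : Subshift P → G ≃ₜ G}
    (hh : GeomHolderOn E q h Set.univ) (hq : q < 1) :
    Continuous fun z : Subshift P × G => h z.1 z.2 := by
  have hc : Continuous fun x => (h x : C(G, G)) := by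
    refine continuous_iff_continuousAt.2 fun x => EMetric.tendsto_nhds.2 fun ε hε => ?_
    obtain ⟨N, hN⟩ := ((tendsto_geom (E := E) hq).eventually (gt_mem_nhds hε)).exists
    filter_upwards [(isOpen_agree N x).mem_nhds fun _ _ => rfl] with y hy
    rw [← uniformDist_eq_edist]
    exact (hh y trivial x trivial N (Agree.symm hy)).trans_lt hN
  exact (hc.comp continuous_fst).eval continuous_snd

/-- A Hölder family of uniformly bi-Hölder homeomorphisms over a dense set extends. -/
theorem GeomHolderOn.exists_extension [CompactSpace G] {E q M β : ℝ≥0} {h : Subshift P → G ≃ₜ G}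
    {S : Set (Subshift P)} (hh : GeomHolderOn E q h S) (hq : q < 1) (hβ : 0 < β) (hS : Dense S)
    (hM : ∀ x, HolderWith M β (h x)) (hM' : ∀ x, HolderWith M β ((h x)⁻¹ : G ≃ₜ G)) :
    ∃ h' : Subshift P → G ≃ₜ G, GeomHolderOn (3 * E) q h' Set.univ ∧ (∀ x ∈ S, h x = h' x) ∧
      (∀ x, HolderWith M β (h' x)) ∧ ∀ x, HolderWith M β ((h' x)⁻¹ : G ≃ₜ G) := by
  have hex : ∀ (x : Subshift P) (n : ℕ), ∃ z ∈ S, Agree n x z := fun x n => by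
    obtain ⟨z, hz, hzS⟩ := hS.inter_open_nonempty _ (isOpen_agree n x) ⟨x, fun _ _ => rfl⟩
    exact ⟨z, hzS, hz⟩
  choose z hzS hz using hex
  have hlim := tendsto_geom (E := E) hq
  have hlim' : Tendsto (fun n => (M : ℝ≥0∞) * ((E * q ^ n : ℝ≥0) : ℝ≥0∞) ^ (β : ℝ)) atTop (𝓝 0) := by
    have hc : Continuous fun t : ℝ≥0∞ => (M : ℝ≥0∞) * t ^ (β : ℝ) :=
      (ENNReal.continuous_const_mul ENNReal.coe_ne_top).comp ENNReal.continuous_rpow_const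
    have := (hc.tendsto 0).comp hlim
    rwa [ENNReal.zero_rpow_of_pos (by exact_mod_cast hβ), mul_zero] at this
  have hzz : ∀ x n m, n ≤ m → uniformDist (h (z x n)) (h (z x m)) ≤ (E * q ^ n : ℝ≥0) :=
    fun x n m hnm => hh _ (hzS x n) _ (hzS x m) n ((hz x n).symm.trans ((hz x m).mono hnm))
  choose h' hh' hh'' using fun x => exists_uniform_limit (h := fun n => h (z x n)) hlim hlim'
    (hzz x) fun n m hnm => (uniformDist_inv_le (hM' _) _).trans (by gcongr; exact hzz x n m hnm)
  refine ⟨h', fun x _ y _ N hxy => ?_, fun x hx => ?_, fun x => ?_, fun x => ?_⟩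
  · calc uniformDist (h' x) (h' y)
        ≤ uniformDist (h' x) (h (z x N)) + uniformDist (h (z x N)) (h' y) :=
          uniformDist_triangle _ _ _
      _ ≤ uniformDist (h' x) (h (z x N)) +
          (uniformDist (h (z x N)) (h (z y N)) + uniformDist (h (z y N)) (h' y)) := by
          gcongr; exact uniformDist_triangle _ _ _
      _ ≤ (E * q ^ N : ℝ≥0) + ((E * q ^ N : ℝ≥0) + (E * q ^ N : ℝ≥0)) := by
          refine add_le_add ?_ (add_le_add ?_ (hh' y N))
          · rw [uniformDist_comm]; exact hh' x N
          · exact hh _ (hzS x N) _ (hzS y N) N ((hz x N).symm.trans (hxy.trans (hz y N)))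
      _ = _ := by rw [← ENNReal.coe_add, ← ENNReal.coe_add]; congr 1; ring
  · refine eq_of_uniformDist_eq_zero (le_antisymm ?_ zero_le)
    have h2 := hlim.add hlim
    rw [add_zero] at h2
    refine ge_of_tendsto h2 (Eventually.of_forall fun n => ?_)
    exact (uniformDist_triangle _ (h (z x n)) _).trans
      (add_le_add (hh _ hx _ (hzS x n) n (hz x n)) (hh' x n))
  · exact holderWith_of_tendsto (fun n => hM (z x n)) (tendsto_of_tendsto_of_tendsto_of_le_of_le
      tendsto_const_nhds hlim (fun _ => zero_le) (hh' x))
  · exact holderWith_of_tendsto (fun n => hM' (z x n)) (tendsto_of_tendsto_of_tendsto_of_le_of_le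
      tendsto_const_nhds hlim' (fun _ => zero_le) (hh'' x))

/-- A family of homeomorphisms that is Hölder along stable and along unstable sets of a set of full
measure is Hölder on a set of full measure: almost all pairs of points are joined by a stable and
an unstable leg through their bracket, and by Fubini's theorem almost every point forms such a
pair with almost every point. -/
theorem exists_geomHolderOn [CompactSpace G] {μ : Measure (Subshift P)} [IsProbabilityMeasure μ]
    [μ.IsOpenPosMeasure] (hμ : HasLocalProductStructure μ) {E q : ℝ≥0} {h : Subshift P → G ≃ₜ G}
    {S : Set (Subshift P)} (hS : ∀ᵐ x ∂μ, x ∈ S)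
    (hh : ∀ x ∈ S, ∀ y ∈ S, (y ∈ localStable x ∨ y ∈ localUnstable x) → ∀ N, Agree N x y →
      uniformDist (h x) (h y) ≤ (E * q ^ N : ℝ≥0)) :
    ∃ (X : Set (Subshift P)) (E' : ℝ≥0), (∀ᵐ x ∂μ, x ∈ X) ∧ GeomHolderOn E' q h X := by
  obtain ⟨D, hD⟩ := exists_edist_le G
  have hpair : ∀ᵐ p ∂μ.prod μ, ∀ N, Agree N p.1 p.2 →
      uniformDist (h p.1) (h p.2) ≤ ((2 * E + D) * q ^ N : ℝ≥0) := by
    filter_upwards [hμ.ae_bracket hS, Measure.quasiMeasurePreserving_fst.ae hS,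
      Measure.quasiMeasurePreserving_snd.ae hS] with p hp h1 h2 N hN
    -- points of different cylinders `[0; i]` have no bracket, but agree only to order `0`
    rcases Nat.eq_zero_or_pos N with rfl | hN0
    · refine (iSup_le fun t => hD _ _).trans (ENNReal.coe_le_coe.2 ?_)
      rw [pow_zero, mul_one]
      exact le_add_self
    obtain ⟨z, hzS, hz1, hz2⟩ := hp (hN 0 (by simpa using hN0))
    have a1 : Agree N p.1 z := fun n hn => by
      rcases le_total n 0 with h0 | h0
      · exact hz1 n h0
      · exact (hN n hn).trans (hz2 n h0)
    have a2 : Agree N p.2 z := hN.symm.trans a1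
    calc uniformDist (h p.1) (h p.2) ≤ uniformDist (h p.1) (h z) + uniformDist (h z) (h p.2) :=
          uniformDist_triangle _ _ _
      _ ≤ (E * q ^ N : ℝ≥0) + (E * q ^ N : ℝ≥0) := by
          rw [uniformDist_comm (h z)]
          exact add_le_add (hh _ h1 z hzS (Or.inr hz1) N a1) (hh _ h2 z hzS (Or.inl hz2) N a2)
      _ ≤ _ := by
          rw [← ENNReal.coe_add, ENNReal.coe_le_coe, ← two_mul, ← mul_assoc]
          gcongr
          exact le_self_add
  refine ⟨_, 2 * (2 * E + D), Measure.ae_ae_of_ae_prod hpair, fun x hx y hy N hxy => ?_⟩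
  -- `x` and `y` are compared through a common partner that agrees with `x` to order `N`
  have hxy' := Filter.Eventually.and (f := ae μ) hx hy
  obtain ⟨z, hz, hz1, hz2⟩ := (Measure.dense_of_ae hxy').inter_open_nonempty _
    (isOpen_agree N x) ⟨x, fun _ _ => rfl⟩
  calc uniformDist (h x) (h y) ≤ uniformDist (h x) (h z) + uniformDist (h z) (h y) :=
        uniformDist_triangle _ _ _
    _ ≤ ((2 * E + D) * q ^ N : ℝ≥0) + ((2 * E + D) * q ^ N : ℝ≥0) := by
        rw [uniformDist_comm (h z)]
        exact add_le_add (hz1 N hz) (hz2 N (hxy.symm.trans hz))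
    _ = _ := by rw [← ENNReal.coe_add]; congr 1; ring

/-- The conjugacy equation passes from a dense set to the whole subshift by continuity. -/
theorem IsConjugacy.of_dense [CompactSpace G] {f g φ φ' : Subshift P → G ≃ₜ G} {E q r C C' : ℝ≥0}
    (hφ : IsConjugacy f g φ) (hφ' : GeomHolderOn E q φ' Set.univ) (hq : q < 1)
    (hf : GeomHolderOn C r f Set.univ) (hg : GeomHolderOn C' r g Set.univ) (hr : r < 1)
    (hd : Dense {x | φ x = φ' x ∧ φ (shift P x) = φ' (shift P x)}) : IsConjugacy f g φ' := by
  have hφc := hφ'.continuous_uncurry hq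
  have hfc := hf.continuous_uncurry hr
  have hgc := hg.continuous_uncurry hr
  have key : ∀ p x, f x (φ' x p) = φ' (shift P x) (g x p) := fun p => by
    refine congrFun (Continuous.ext_on hd ?_ ?_ fun x hx => ?_)
    · exact hfc.comp (continuous_id.prodMk (hφc.comp (continuous_id.prodMk continuous_const)))
    · exact hφc.comp (continuous_shift.prodMk (hgc.comp (continuous_id.prodMk continuous_const)))
    · have := DFunLike.congr_fun (hφ x) (φ x p)
      rw [← hx.1, ← hx.2, this]
      exact congrArg (fun t => φ (shift P x) (g x t)) ((φ x).symm_apply_apply p)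
  intro x
  rw [eq_mul_inv_iff_mul_eq]
  exact Homeomorph.ext fun p => key p x

end Extension

/-! ### Hölder and dominated cocycles -/

section Cocycles

variable {k : ℕ} {P : Matrix (Fin k) (Fin k) ℕ} {G : Type*} [MetricSpace G]

theorem inv_pow_rpow {ρ : ℝ} (h0 : 0 < ρ) (N : ℕ) (η : ℝ) :
    ((ρ ^ N)⁻¹) ^ η = (ρ ^ (-η)) ^ N := by
  rw [← Real.rpow_natCast, ← Real.rpow_natCast, ← Real.rpow_neg h0.le, ← Real.rpow_mul h0.le,
    ← Real.rpow_mul h0.le]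
  congr 1; ring

theorem IsHolderCocycle.exists_geomHolderOn [AddGroup G] {ρ : ℝ} (hρ : 1 < ρ) {α : ℝ≥0}
    {f : Subshift P → G ≃ₜ G} (hf : IsHolderCocycle ρ α f) :
    ∃ C : ℝ≥0, GeomHolderOn C (ρ ^ (-(α : ℝ))).toNNReal f Set.univ := by
  obtain ⟨-, C, hC⟩ := hf
  have h0 : 0 < ρ := one_pos.trans hρ
  refine ⟨C, fun x _ y _ N hN => (le_self_add.trans (hC x y)).trans ?_⟩
  rw [← ENNReal.ofReal_coe_nnreal]
  refine ENNReal.ofReal_le_ofReal ?_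
  push_cast
  rw [Real.coe_toNNReal _ (Real.rpow_nonneg h0.le _)]
  gcongr
  calc shiftDist ρ x y ^ (α : ℝ) ≤ ((ρ ^ N)⁻¹) ^ (α : ℝ) := by
        refine Real.rpow_le_rpow ?_ (shiftDist_le hρ hN) α.2
        rw [shiftDist]; split_ifs <;> positivity
    _ = _ := inv_pow_rpow h0 _ _

theorem GeomHolderOn.isUniformHolder {ρ : ℝ} (hρ : 1 < ρ) {E q : ℝ≥0} {η : ℝ}
    {h : Subshift P → G ≃ₜ G} (hh : GeomHolderOn E q h Set.univ) (hq : (q : ℝ) ≤ ρ ^ (-η)) :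
    IsUniformHolder ρ η h := by
  have h0 : 0 < ρ := one_pos.trans hρ
  refine ⟨E, fun x y => ?_⟩
  rcases eq_or_ne x y with rfl | hxy
  · rw [uniformDist_self]; exact zero_le
  obtain ⟨N, hN, hd⟩ := exists_agree_shiftDist ρ hxy
  refine (hh x trivial y trivial N hN).trans ?_
  rw [hd, ← ENNReal.ofReal_coe_nnreal]
  refine ENNReal.ofReal_le_ofReal ?_
  push_cast
  gcongr
  calc (q : ℝ) ^ N ≤ (ρ ^ (-η)) ^ N := by gcongr
    _ = _ := (inv_pow_rpow h0 _ _).symm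

/-- A rate `l` with `l ρ ^ (-α) < 1` that bounds the Lipschitz constants of an `su`-dominated
cocycle. -/
theorem IsSUDominated.exists_lipschitzWith {ρ : ℝ} (hρ : 1 < ρ) {α : ℝ≥0} (hα : 0 < α)
    {f : Subshift P → G ≃ₜ G} (hf : IsSUDominated ρ α f) :
    ∃ l : ℝ≥0, 1 ≤ l ∧ l * (ρ ^ (-(α : ℝ))).toNNReal < 1 ∧
      (∀ x, LipschitzWith l (f x)) ∧ ∀ x, LipschitzWith l ((f x)⁻¹ : G ≃ₜ G) := by
  obtain ⟨⟨θ, hθ, hs⟩, ⟨θ', hθ', hu⟩⟩ := hf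
  have h0 : 0 < ρ := one_pos.trans hρ
  have hmul : ∀ t : ℝ, 0 < t → (ρ ^ ((α : ℝ) - t)).toNNReal * (ρ ^ (-(α : ℝ))).toNNReal < 1 := by
    intro t ht
    rw [← Real.toNNReal_mul (Real.rpow_nonneg h0.le _), ← Real.rpow_add h0, Real.toNNReal_lt_one]
    exact Real.rpow_lt_one_of_one_lt_of_neg hρ (by linarith)
  refine ⟨max 1 (max (ρ ^ ((α : ℝ) - θ)).toNNReal (ρ ^ ((α : ℝ) - θ')).toNNReal), le_max_left _ _,
    ?_, fun x => ?_, fun x => ?_⟩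
  · rw [max_mul, max_mul, one_mul]
    refine max_lt ?_ (max_lt (hmul θ hθ) (hmul θ' hθ'))
    rw [Real.toNNReal_lt_one]
    exact Real.rpow_lt_one_of_one_lt_of_neg hρ (by simpa using hα)
  · exact (holderWith_one.1 (holderWith_of_eHolderNorm_le (hu x).le)).weaken
      ((le_max_right _ _).trans (le_max_right _ _))
  · exact (holderWith_one.1 (holderWith_of_eHolderNorm_le (hs x).le)).weaken
      ((le_max_left _ _).trans (le_max_right _ _))

theorem shift_symm_iterate_succ (n : ℕ) (x : Subshift P) :
    shift P ((shift P).symm^[n + 1] x) = (shift P).symm^[n] x := by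
  rw [Function.iterate_succ_apply', Equiv.apply_symm_apply]

/-- The backward fibre maps over points with a common past approach each other. -/
theorem GeomHolderOn.uniformDist_inv_backward_le {C r l : ℝ≥0} {f : Subshift P → G ≃ₜ G}
    (hf : GeomHolderOn C r f Set.univ) (hr : r ≤ 1)
    {x y : Subshift P} (hl : ∀ n, LipschitzWith l ((f ((shift P).symm^[n] x))⁻¹ : G ≃ₜ G))
    (hxy : y ∈ localUnstable x) {N : ℕ} (hN : Agree N x y) (n : ℕ) :
    uniformDist (f ((shift P).symm^[n + 1] x))⁻¹ (f ((shift P).symm^[n + 1] y))⁻¹ ≤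
      (l * C * r ^ N * r ^ n : ℝ≥0) := by
  have h1 := uniformDist_inv_le (holderWith_one.2 (hl (n + 1))) (f ((shift P).symm^[n + 1] y))
  refine h1.trans ?_
  rw [NNReal.coe_one, ENNReal.rpow_one, mul_assoc, mul_assoc, ENNReal.coe_mul]
  gcongr
  refine (hf _ trivial _ trivial _ (agree_iterate_shift_symm hxy hN (n + 1))).trans ?_
  rw [← pow_add]
  exact ENNReal.coe_le_coe.2 (mul_le_mul' le_rfl (pow_le_pow_of_le_one zero_le hr (by omega)))

end Cocycles

/-! ### Regularity of a measurable conjugacy -/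

section Rigidity

variable {k : ℕ} {P : Matrix (Fin k) (Fin k) ℕ} {G : Type*} [MetricSpace G] [CompactSpace G]

/-- Holonomies of a dominated cocycle. Their unstable version is the stable one for the inverse
fibre maps along backward orbits. -/
theorem GeomHolderOn.hasHolderHolonomies {C r l α : ℝ≥0} {f : Subshift P → G ≃ₜ G}
    (hf : GeomHolderOn C r f Set.univ) (hr : 0 < r) (hr1 : r ≤ 1) (hl : 1 ≤ l) (hs : l * r < 1)
    (hα : 0 < α) (hfl : ∀ x, LipschitzWith l (f x))
    (hfl' : ∀ x, LipschitzWith l ((f x)⁻¹ : G ≃ₜ G)) :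
    ∃ γ : ℝ≥0, 0 < γ ∧ γ < α ∧ HasHolderHolonomies f γ := by
  obtain ⟨γ, hγ, hγα, C', hC'⟩ := exists_holder_limit_compSeq (G := G) (l * C) hr hl hs hα
  refine ⟨γ, hγ, hγα, C', fun x y hxy => ?_, fun x y hxy => ?_⟩
  · obtain ⟨h, hh, hhC⟩ := hC' (fun n => f ((shift P)^[n] x)) (fun n => f ((shift P)^[n] y))
      (fun n => hfl _) (fun n => hfl' _) (fun n => hfl' _) fun n =>
        ((hf _ trivial _ trivial _ (agree_iterate_shift hxy (agree_zero x y) n)).trans (by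
          rw [zero_add]
          gcongr
          exact le_mul_of_one_le_left' hl))
    refine ⟨h, ?_, hhC.eHolderNorm_le⟩
    simpa only [IsStableHolonomy, iter_eq_compSeq] using hh
  · obtain ⟨h, hh, hhC⟩ := hC' (fun n => (f ((shift P).symm^[n + 1] x))⁻¹)
      (fun n => (f ((shift P).symm^[n + 1] y))⁻¹)
      (fun n => hfl' _) (fun n => by rw [inv_inv]; exact hfl _)
      (fun n => by rw [inv_inv]; exact hfl _) fun n => by
        simpa using hf.uniformDist_inv_backward_le hr1 (fun n => hfl' _) hxy (agree_zero x y) n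
    refine ⟨h, ?_, hhC.eHolderNorm_le⟩
    simpa only [IsUnstableHolonomy, backIter_eq_compSeq] using hh

/-- A measurable family of homeomorphisms takes close values at common times along almost all pairs
of asymptotic orbits. -/
theorem IsUniformMeasurable.exists_ae_uniformDist_lt {μ : Measure (Subshift P)} [IsFiniteMeasure μ]
    {φ : Subshift P → G ≃ₜ G} (hφ : IsUniformMeasurable μ φ) {T : Subshift P → Subshift P}
    (hT : MeasurePreserving T μ μ) :
    ∃ S : Set (Subshift P), (∀ᵐ x ∂μ, x ∈ S) ∧ ∀ x ∈ S, ∀ y ∈ S,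
      (∀ n, Agree n (T^[n] x) (T^[n] y)) →
        ∀ ε : ℝ≥0∞, 0 < ε → ∃ n, uniformDist (φ (T^[n] x)) (φ (T^[n] y)) < ε := by
  -- as a subset of the separable space `C(G, G)`, the space of homeomorphisms is separable
  let R := Set.range fun h : G ≃ₜ G => (h : C(G, G))
  let Φ : Subshift P → R := fun x => ⟨φ x, φ x, rfl⟩
  have : Nonempty R := ⟨⟨_, 1, rfl⟩⟩
  have hΦ : ∀ (y : R) (ε : ℝ≥0∞), NullMeasurableSet {x | edist (Φ x) y < ε} μ := by
    rintro ⟨_, h, rfl⟩ ε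
    have e : {x | edist (Φ x) ⟨_, h, rfl⟩ < ε} = φ ⁻¹' {u | uniformDist u h < ε} := by
      ext x
      simp only [Set.mem_ofPred_eq, Set.mem_preimage, uniformDist_eq_edist]
      rfl
    rw [e]
    refine hφ _ fun u hu => ⟨ε - uniformDist u h, tsub_pos_of_lt hu, fun v hv => ?_⟩
    have h1 : uniformDist v u + uniformDist u h < ε := by
      rw [uniformDist_comm v]
      exact lt_tsub_iff_right.1 hv
    exact (uniformDist_triangle v u h).trans_lt h1
  obtain ⟨S, hS, H⟩ := exists_ae_edist_iterate_lt hΦ hT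
  refine ⟨S, hS, fun x hx y hy hxy ε hε => ?_⟩
  obtain ⟨n, hn⟩ := H x hx y hy hxy ε hε
  exact ⟨n, by rw [uniformDist_eq_edist]; exact hn⟩

theorem add_rpow_le_geom {A B M r β : ℝ≥0} (hr0 : 0 < r) (hr : r ≤ 1) (hβ1 : β ≤ 1) (N : ℕ) :
    A * r ^ N + M * (B * r ^ N) ^ (β : ℝ) ≤ (A + M * B ^ (β : ℝ)) * (r ^ (β : ℝ)) ^ N := by
  have e : (r ^ N) ^ (β : ℝ) = (r ^ (β : ℝ)) ^ N := by
    rw [← NNReal.rpow_natCast, ← NNReal.rpow_natCast, ← NNReal.rpow_mul, ← NNReal.rpow_mul, mul_comm]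
  have h1 : r ^ N ≤ (r ^ (β : ℝ)) ^ N := by
    gcongr
    simpa using NNReal.rpow_le_rpow_of_exponent_ge hr0 hr (show (β : ℝ) ≤ 1 from hβ1)
  rw [NNReal.mul_rpow, e, add_mul, mul_assoc M]
  gcongr

/-- A measurable conjugacy is Hölder along the stable and unstable sets of almost all points. -/
theorem IsConjugacy.exists_ae_holder_along_leaves {μ : Measure (Subshift P)} [IsFiniteMeasure μ]
    {C r l K M β : ℝ≥0} {f g φ : Subshift P → G ≃ₜ G} (hμ : MeasurePreserving (shift P) μ μ)
    (hφ : IsConjugacy f g φ) (hφmeas : IsUniformMeasurable μ φ)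
    (hf : GeomHolderOn C r f Set.univ) (hg : GeomHolderOn C r g Set.univ) (hr0 : 0 < r) (hr : r < 1)
    (hl : 1 ≤ l) (hs : l * r < 1) (hβ : 0 < β) (hβ1 : β ≤ 1)
    (hfl : ∀ x, LipschitzWith l (f x)) (hfl' : ∀ x, LipschitzWith l ((f x)⁻¹ : G ≃ₜ G))
    (hgK : ∀ᵐ x ∂μ, ∀ n, LipschitzWith K (iter g n x) ∧
      LipschitzWith K ((iter g n x)⁻¹ : G ≃ₜ G))
    (hM : ∀ x, HolderWith M β (φ x)) (hM' : ∀ x, HolderWith M β ((φ x)⁻¹ : G ≃ₜ G)) :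
    ∃ (S : Set (Subshift P)) (E : ℝ≥0), (∀ᵐ x ∂μ, x ∈ S) ∧ ∀ x ∈ S, ∀ y ∈ S,
      (y ∈ localStable x ∨ y ∈ localUnstable x) → ∀ N, Agree N x y →
        uniformDist (φ x) (φ y) ≤ (E * (r ^ (β : ℝ)) ^ N : ℝ≥0) := by
  have hμ' := measurePreserving_shift_symm hμ
  obtain ⟨S₁, hS₁, H₁⟩ := hφmeas.exists_ae_uniformDist_lt hμ
  obtain ⟨S₂, hS₂, H₂⟩ := hφmeas.exists_ae_uniformDist_lt hμ'
  have hS₃ : ∀ᵐ x ∂μ, ∀ m n, LipschitzWith K (iter g n ((shift P).symm^[m] x)) ∧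
      LipschitzWith K ((iter g n ((shift P).symm^[m] x))⁻¹ : G ≃ₜ G) :=
    ae_all_iff.2 fun m => (hμ'.iterate m).quasiMeasurePreserving.ae hgK
  -- one constant for `f` and `g`, forwards and (through the inverse fibre maps) backwards
  set C' : ℝ≥0 := (l + K) * C with hC'
  have hCC' : C ≤ C' := le_mul_of_one_le_left' (hl.trans le_self_add)
  have hlC' : l * C ≤ C' := mul_le_mul' le_self_add le_rfl
  have hKC' : K * C ≤ C' := mul_le_mul' le_add_self le_rfl
  refine ⟨_, l * C' / (1 - l * r) + M * (K * C' / (1 - r)) ^ (β : ℝ),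
    (hS₁.and hS₂).and hS₃, fun x hx y hy hxy N hN => ?_⟩
  obtain ⟨⟨hx₁, hx₂⟩, hx₃⟩ := hx
  obtain ⟨⟨hy₁, hy₂⟩, hy₃⟩ := hy
  suffices h : uniformDist (φ x) (φ y) ≤
      (l * (C' * r ^ N) / (1 - l * r) + M * (K * (C' * r ^ N) / (1 - r)) ^ (β : ℝ) : ℝ≥0) by
    refine h.trans (ENNReal.coe_le_coe.2 ?_)
    have := add_rpow_le_geom (A := l * C' / (1 - l * r)) (B := K * C' / (1 - r)) (M := M)
      hr0 hr.le hβ1 N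
    rwa [div_mul_eq_mul_div, div_mul_eq_mul_div, mul_assoc l C', mul_assoc K C'] at this
  rcases hxy with hxy | hxy
  · have bound : ∀ {h : Subshift P → G ≃ₜ G}, GeomHolderOn C r h Set.univ → ∀ n,
        uniformDist (h ((shift P)^[n] x)) (h ((shift P)^[n] y)) ≤ (C' * r ^ N * r ^ n : ℝ≥0) :=
      fun hh n => (hh _ trivial _ trivial _ (agree_iterate_shift hxy hN n)).trans (by
        rw [mul_assoc, ← pow_add]
        gcongr)
    refine uniformDist_le_of_conj (u := fun n => φ ((shift P)^[n] x))
      (v := fun n => φ ((shift P)^[n] y)) hr hs hβ (fun n => ?_) (fun n => ?_) (fun n => hfl' _)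
      (fun n => ?_) (bound hf) (bound hg) (hM _) (fun n => hM' _)
      (H₁ x hx₁ y hy₁ fun n => (agree_iterate_shift hxy (agree_zero x y) n).mono (by omega))
    · rw [Function.iterate_succ_apply']; exact hφ _
    · rw [Function.iterate_succ_apply']; exact hφ _
    · rw [← iter_eq_compSeq]; exact (hy₃ 0 n).2
  · have bound : ∀ {h : Subshift P → G ≃ₜ G} {L : ℝ≥0}, GeomHolderOn C r h Set.univ →
        (∀ n, LipschitzWith L ((h ((shift P).symm^[n] x))⁻¹ : G ≃ₜ G)) → L * C ≤ C' → ∀ n,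
        uniformDist (h ((shift P).symm^[n + 1] x))⁻¹ (h ((shift P).symm^[n + 1] y))⁻¹ ≤
          (C' * r ^ N * r ^ n : ℝ≥0) :=
      fun hh hL hLC n => (hh.uniformDist_inv_backward_le hr.le hL hxy hN n).trans (by gcongr)
    have conj : ∀ z n, (f ((shift P).symm^[n + 1] z))⁻¹ = φ ((shift P).symm^[n + 1] z) *
        (g ((shift P).symm^[n + 1] z))⁻¹ * (φ ((shift P).symm^[n] z))⁻¹ := fun z n => by
      rw [hφ, shift_symm_iterate_succ]; group
    refine uniformDist_le_of_conj (u := fun n => φ ((shift P).symm^[n] x))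
      (v := fun n => φ ((shift P).symm^[n] y)) hr hs hβ (conj x) (conj y)
      (fun n => by rw [inv_inv]; exact hfl _) (fun n => ?_) (bound hf (fun n => hfl' _) hlC')
      (bound hg (fun n => ?_) hKC') (hM _) (fun n => hM' _)
      (H₂ x hx₂ y hy₂ fun n => (agree_iterate_shift_symm hxy (agree_zero x y) n).mono (by omega))
    -- the inverse of a backward iterate at `y` is a forward iterate at `σ⁻ⁿ y`
    · rw [← backIter_eq_compSeq, backIter, inv_inv]; exact (hy₃ n n).1
    · simpa [iter] using (hx₃ n 1).2

end Rigidity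

end LipCocycle

open LipCocycle
theorem corollary1
    {k : ℕ} (P : Matrix (Fin k) (Fin k) ℕ) (hP : IsTransitionMatrix P)
    (ρ : ℝ) (hρ : 1 < ρ)
    {G : Type*} [AddGroup G] [MetricSpace G] [IsTopologicalAddGroup G] [CompactSpace G]
    (α β : ℝ≥0) (hα : 0 < α) (hβ : 0 < β) (hβ1 : β ≤ 1)
    (μ : Measure (Subshift P)) [IsProbabilityMeasure μ] [μ.IsOpenPosMeasure]
    (hμ : Ergodic (shift P) μ) (hμprod : HasLocalProductStructure μ)
    (f g : Subshift P → G ≃ₜ G)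
    (hf : IsHolderCocycle ρ α f) (hg : IsHolderCocycle ρ α g)
    (hfdom : IsSUDominated ρ α f) (hgdist : HasBoundedDistortion μ g)
    (φ : Subshift P → G ≃ₜ G) (hφmem : ∀ x, φ x ∈ Hol G β)
    (hφmeas : IsUniformMeasurable μ φ) (hφ : IsConjugacy f g φ)
    (hφbdd : ∃ M : ℝ≥0, ∀ x, eHolderNorm β (φ x) ≤ M ∧ eHolderNorm β ((φ x)⁻¹ : G ≃ₜ G) ≤ M) :
    (∃ γ : ℝ≥0, 0 < γ ∧ γ < α ∧ HasHolderHolonomies f γ) ∧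
    ∃ φ' : Subshift P → G ≃ₜ G,
      (∀ γ : ℝ≥0, 0 < γ → γ < α → HasHolderHolonomies f γ →
        IsUniformHolder ρ ((β : ℝ) * γ) φ') ∧
      φ =ᵐ[μ] φ' ∧
      IsConjugacy f g φ' ∧
      ∀ x, φ' x ∈ Hol G β := by
  have h0 : 0 < ρ := one_pos.trans hρ
  obtain ⟨l, hl, hs, hfl, hfl'⟩ := hfdom.exists_lipschitzWith hρ hα
  obtain ⟨Cf, hf'⟩ := hf.exists_geomHolderOn hρ
  obtain ⟨Cg, hg'⟩ := hg.exists_geomHolderOn hρ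
  obtain ⟨K, hK⟩ := hgdist
  obtain ⟨M, hM⟩ := hφbdd
  have hφM : ∀ x, HolderWith M β (φ x) := fun x => holderWith_of_eHolderNorm_le (hM x).1
  have hφM' : ∀ x, HolderWith M β ((φ x)⁻¹ : G ≃ₜ G) :=
    fun x => holderWith_of_eHolderNorm_le (hM x).2
  set r : ℝ≥0 := (ρ ^ (-(α : ℝ))).toNNReal with hr_def
  have hr0 : 0 < r := Real.toNNReal_pos.2 (Real.rpow_pos_of_pos h0 _)
  have hr1 : r < 1 := by
    rw [hr_def, Real.toNNReal_lt_one]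
    exact Real.rpow_lt_one_of_one_lt_of_neg hρ (by simpa using hα)
  have hq1 : r ^ (β : ℝ) < 1 := NNReal.rpow_lt_one hr1 (by exact_mod_cast hβ)
  refine ⟨hf'.hasHolderHolonomies hr0 hr1.le hl hs hα hfl hfl', ?_⟩
  have hKL : ∀ᵐ x ∂μ, ∀ n, LipschitzWith K (iter g n x) ∧
      LipschitzWith K ((iter g n x)⁻¹ : G ≃ₜ G) := by
    filter_upwards [hK] with x hx n
    exact ⟨holderWith_one.1 (holderWith_of_eHolderNorm_le (hx n).1.le),
      holderWith_one.1 (holderWith_of_eHolderNorm_le (hx n).2.le)⟩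
  obtain ⟨S, E, hS, hSE⟩ := hφ.exists_ae_holder_along_leaves hμ.toMeasurePreserving hφmeas
    (hf'.mono (le_max_left Cf Cg)) (hg'.mono (le_max_right Cf Cg)) hr0 hr1 hl hs hβ hβ1 hfl hfl'
    hKL hφM hφM'
  obtain ⟨X, E', hX, hXE⟩ := exists_geomHolderOn hμprod hS hSE
  obtain ⟨φ', hφ', hφX, hφ'M, hφ'M'⟩ :=
    hXE.exists_extension hq1 hβ (Measure.dense_of_ae hX) hφM hφM'
  refine ⟨φ', fun γ _ hγα _ => hφ'.isUniformHolder hρ ?_, hX.mono hφX, ?_,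
    fun x => ⟨(hφ'M x).memHolder, (hφ'M' x).memHolder⟩⟩
  -- `φ'` is `βα`-Hölder, and `βγ ≤ βα`
  · rw [NNReal.coe_rpow, hr_def, Real.coe_toNNReal _ (Real.rpow_nonneg h0.le _),
      ← Real.rpow_mul h0.le]
    refine Real.rpow_le_rpow_of_exponent_le hρ.le ?_
    have : (γ : ℝ) ≤ α := by exact_mod_cast hγα.le
    nlinarith [mul_le_mul_of_nonneg_left this β.2]
  · refine hφ.of_dense hφ' hq1 hf' hg' hr1 (Measure.dense_of_ae (μ := μ) ?_)
    filter_upwards [hX, hμ.toMeasurePreserving.quasiMeasurePreserving.ae hX] with x hx hx'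
    exact ⟨hφX x hx, hφX _ hx'⟩
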